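/- **Conventions.** A *diffeological space* is a set $X$ with a set of maps (plots) into $X$ from Euclidean domains that contains the constant maps, is stable under smooth reparametrization, and is local; a map is *smooth* if it sends plots to plots. The *D-topology* of $X$ is the finest topology that makes all plots continuous. $\mathbf{NG}$ denotes the category of numerically generated (equivalently, delta-generated) topological spaces, i.e. those whose topology is coinduced by all continuous maps from the spaces $\mathbb{R}^n$, with continuous maps as morphisms; taking the D-topology gives a functor $D$ from diffeological spaces to $\mathbf{NG}$. Two morphisms $f,g : A \to B$ of $\mathbf{NG}$ are *homotopic* if there are a continuous map $H : A \times \mathbb{R} \to B$ (product in $\mathbf{NG}$) and $0 < \varepsilon < \tfrac12$ with $H(x,t) = f(x)$ for $t \le \varepsilon$ and $H(x,t) = g(x)$ for $t \ge 1-\varepsilon$; *homotopy equivalence in $\mathbf{NG}$* is defined from this as usual. A *smooth CW complex* is a diffeological space $X$ that is the colimit of a sequence $X_0 \to X_1 \to \cdots$ of diffeological spaces, where $X_0$ is discrete and, for every $n \ge 0$, $X_{n+1}$ is the pushout, in the category of diffeological spaces, of a smooth map $h_n : \coprod_\alpha S^n_\alpha \to X_n$ and the inclusion $\coprod_\alpha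 S^n_\alpha \hookrightarrow \coprod_\alpha D^{n+1}_\alpha$; here $S^n$ and $D^{n+1}$ carry the subspace diffeology of $\mathbb{R}^{n+1}$. **Theorem.** Let $Y$ be a (topological) CW complex. Then $Y$ is an object of $\mathbf{NG}$, and there is a smooth CW complex $X$ such that $Y$ is homotopy equivalent in $\mathbf{NG}$ to $D(X)$. -/

import Mathlib

open CategoryTheory Limits Diffeology

universe u v

noncomputable section

/-! ## Diffeological spaces: induced and discrete diffeologies -/

/-- The diffeology induced on `X` by a map `f : X → Y` into a diffeological space: a map `p` into
`X` is a plot exactly when `f ∘ p` is a plot of `Y`. For the inclusion of a subset this is the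
subspace diffeology. -/
@[reducible]
def DiffeologicalSpace.inducedBy {X : Type u} {Y : Type v} [DiffeologicalSpace Y] (f : X → Y) :
    DiffeologicalSpace X where
  plots n := {p | IsPlot (f ∘ p)}
  constant_plots {n} x := isPlot_const (n := n) (x := f x)
  plot_reparam hp hf := isPlot_reparam hp hf
  locality {_n p} hp := DiffeologicalSpace.locality (p := f ∘ p) fun x ↦ by
    obtain ⟨s, hs, hxs, h⟩ := hp x
    exact ⟨s, hs, hxs, fun {_m _g} hg hg' ↦ h hg hg'⟩

/-- A diffeological space is discrete if all its plots are locally constant. -/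
def IsDiscreteDiffeology (X : Type u) [DiffeologicalSpace X] : Prop :=
  ∀ (n : ℕ) (p : EuclideanSpace ℝ (Fin n) → X), IsPlot p → IsLocallyConstant p

/-! ## The category of diffeological spaces -/

/-- Bundled diffeological spaces. -/
structure DiffSpace : Type (u + 1) where
  /-- Bundle a type that carries a diffeology. -/
  of ::
  /-- The underlying type. -/
  carrier : Type u
  /-- The diffeology. -/
  [str : DiffeologicalSpace carrier]

namespace DiffSpace

instance : CoeSort DiffSpace.{u} (Type u) := ⟨carrier⟩

attribute [instance] str

/-- Smooth maps between diffeological spaces. -/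
@[ext]
structure Hom (X Y : DiffSpace.{u}) where
  /-- The underlying map. -/
  toFun : X → Y
  /-- The underlying map sends plots to plots. -/
  smooth : DSmooth toFun

/-- The category of diffeological spaces and smooth maps. -/
instance : Category DiffSpace.{u} where
  Hom X Y := Hom X Y
  id _ := ⟨id, dSmooth_id⟩
  comp f g := ⟨g.toFun ∘ f.toFun, g.smooth.comp f.smooth⟩

/-- The sphere `Sⁿ = {x ∈ ℝⁿ⁺¹ | ‖x‖ = 1}` with the subspace diffeology (its usual diffeology as a
manifold). -/
def sphere (n : ℕ) : DiffSpace.{u} :=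
  letI := DiffeologicalSpace.inducedBy
    (fun x : ULift.{u} (Metric.sphere (0 : EuclideanSpace ℝ (Fin (n + 1))) 1) ↦
      (x.down : EuclideanSpace ℝ (Fin (n + 1))))
  .of (ULift.{u} (Metric.sphere (0 : EuclideanSpace ℝ (Fin (n + 1))) 1))

/-- The closed disk `Dⁿ = {x ∈ ℝⁿ | ‖x‖ ≤ 1}` with the subspace diffeology (its usual diffeology
as a manifold with boundary). -/
def disk (n : ℕ) : DiffSpace.{u} :=
  letI := DiffeologicalSpace.inducedBy
    (fun x : ULift.{u} (Metric.closedBall (0 : EuclideanSpace ℝ (Fin n)) 1) ↦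
      (x.down : EuclideanSpace ℝ (Fin n)))
  .of (ULift.{u} (Metric.closedBall (0 : EuclideanSpace ℝ (Fin n)) 1))

/-- The inclusion `Sⁿ ⟶ Dⁿ⁺¹`. -/
def sphereInclusion (n : ℕ) : sphere.{u} n ⟶ disk.{u} (n + 1) where
  toFun x := ⟨⟨x.down.1, Metric.sphere_subset_closedBall x.down.2⟩⟩
  smooth _ _ hp := hp

/-- The structure of a smooth CW complex on a diffeological space `X`: it is the colimit of a
sequence of skeleta, starting with a discrete one, where the `(n+1)`-skeleton is the pushout, in
the category of diffeological spaces, of the `n`-skeleton and a disjoint union of disks `Dⁿ⁺¹` along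
a smooth attaching map defined on the disjoint union of their boundary spheres `Sⁿ`. -/
structure SmoothCWComplex (X : DiffSpace.{u}) where
  /-- The sequence of skeleta. -/
  skeleton : ℕ ⥤ DiffSpace.{u}
  /-- The `0`-skeleton is discrete. -/
  discrete_zero : IsDiscreteDiffeology (skeleton.obj 0)
  /-- The `(n+1)`-skeleton arises from the `n`-skeleton by attaching `(n+1)`-cells, by a pushout of
  a coproduct of copies of `Sⁿ ⟶ Dⁿ⁺¹`. -/
  attachCells (n : ℕ) : HomotopicalAlgebra.AttachCells.{u} (fun _ : Unit ↦ sphereInclusion.{u} n)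
    (skeleton.map (homOfLE (Nat.le_succ n)))
  /-- The maps from the skeleta to `X`. -/
  incl : skeleton ⟶ (Functor.const ℕ).obj X
  /-- `X` is the colimit of its skeleta. -/
  isColimit : IsColimit (Cocone.mk X incl)

/-! ## The D-topology functor -/

/-- The D-topology of a diffeological space is delta-generated. -/
lemma deltaGeneratedSpace_dTopology (X : Type u) [DiffeologicalSpace X] :
    @DeltaGeneratedSpace X dTopology := by
  let _ : TopologicalSpace X := dTopology
  refine ⟨?_⟩
  rw [continuous_def]
  intro U hU
  rw [Topology.WithGeneratedByTopology.isOpen_iff] at hU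
  refine isOpen_iff_preimages_plots.2 fun n p hp ↦ ?_
  let e := EuclideanSpace.equiv (Fin n) ℝ
  have h := (hU ⟨p ∘ e.symm, hp.continuous.comp e.symm.continuous⟩).preimage e.continuous
  convert h using 1
  ext x
  simp [e]

/-- The functor `D` from diffeological spaces to delta-generated (that is, numerically generated)
spaces, which equips a diffeological space with its D-topology. -/
def dTop : DiffSpace.{u} ⥤ DeltaGenerated.{u} where
  obj X := @DeltaGenerated.of X dTopology (deltaGeneratedSpace_dTopology X)
  map {X Y} f :=
    letI : TopologicalSpace X := dTopology
    letI : TopologicalSpace Y := dTopology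
    ObjectProperty.homMk (TopCat.ofHom ⟨f.toFun, f.smooth.continuous⟩)

end DiffSpace

/-! ## Homotopy in the category of delta-generated spaces -/

namespace DeltaGenerated

/-- The product of `A` and `ℝ` in the category of delta-generated spaces: the set `A × ℝ` with the
delta-generated topology associated with the product topology. -/
def prodReal (A : DeltaGenerated.{u}) : DeltaGenerated.{u} :=
  DeltaGenerated.of (DeltaGeneratedSpace.of (Y := A × ℝ))

/-- The point `(x, t)` of the product of `A` and `ℝ`. -/
def prodReal.mk {A : DeltaGenerated.{u}} (x : A) (t : ℝ) : prodReal A :=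
  (Topology.WithGeneratedByTopology.equiv (X := fun n ↦ Fin n → ℝ) (Y := A × ℝ)).symm (x, t)

/-- Two morphisms `f, g : A ⟶ B` of delta-generated spaces are homotopic if there is a morphism `H`
from the product of `A` and `ℝ` to `B` with `H (x, t) = f x` for `t ≤ ε` and `H (x, t) = g x` for
`t ≥ 1 - ε`, for some small `ε > 0`. -/
def Homotopic {A B : DeltaGenerated.{u}} (f g : A ⟶ B) : Prop :=
  ∃ (H : prodReal A ⟶ B) (ε : ℝ), 0 < ε ∧ ε < 1 / 2 ∧ ∀ (x : A) (t : ℝ),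
    (t ≤ ε → H (prodReal.mk x t) = f x) ∧ (1 - ε ≤ t → H (prodReal.mk x t) = g x)

/-- Homotopy equivalence in the category of delta-generated spaces. -/
def HomotopyEquivalent (A B : DeltaGenerated.{u}) : Prop :=
  ∃ (φ : A ⟶ B) (ψ : B ⟶ A), Homotopic (φ ≫ ψ) (𝟙 A) ∧ Homotopic (ψ ≫ φ) (𝟙 B)

end DeltaGenerated

end

/-!
The proof builds, along the skeleta `A n` of the given CW complex `Y`, a smooth CW complex with
skeleta `X n` and a third sequence of spaces `Z n` with maps `A n ⟶ Z n ⟵ X n` (`Stage`,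
`StageStep`), both of which turn out to be inclusions of deformation retracts. If this is known at
stage `n`, the attaching maps of the next cells of `Y` can be transported to continuous maps from
spheres to `X n`; these are homotopic to smooth maps, along which disks are attached to `X n` to
give `X (n + 1)`. The space `Z (n + 1)` arises from `Z n` by attaching cylinders over disks, one for
each cell, along the homotopy between the two attaching maps: its bottoms give the map from
`A (n + 1)`, its tops the map from `X (n + 1)` (`Stage.exists_step`).

Instead of homotopy equivalences, which do not pass to colimits, the induction carries a lifting
property: `CylLift p` says that `p` has the right lifting property for the inclusions of the sides
and the bottom in the cylinders over disks, and `CylAnodyne i` that `i` lifts against all such `p`.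
Attaching cylinders preserves this property in a relative form (`RelCylAnodyne`), which survives the
passage to the colimit of the sequence (`CylAnodyne.of_isSeqColimit`). The maps from a space to the
point and from a path space to the pair of end points satisfy `CylLift`, so an anodyne map is the
inclusion of a deformation retract (`CylAnodyne.exists_retraction`). Applied to the colimits
`Y ⟶ Z ⟵ X`, this gives the homotopy equivalence. All homotopies are continuous for the usual
product topology, hence also for the finer product topology in delta-generated spaces.

The analytic ingredient is that continuous maps to the D-topology of `X n` can be smoothed. The
property `DiffSpace.SmoothApprox X` states this for maps from open subsets `M` of `ℝᵏ`, relative to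
a closed subset near which the map is a plot already. It passes from `X` to the space `attach h`
obtained by attaching disks along smooth maps (`DiffSpace.SmoothApprox.attach`): the map is first
smoothed inside the open cells by approximating its coordinates there, then it is pushed out
radially to `X` wherever it lies outside the half-sized disks, and on that part of `M` the property
of `X` applies. In `attach h` a map is a plot if it locally lifts to a plot of `X` or of a closed
disk, so the point is to glue in such a way that one of the two is the case near each point. A
continuous map on a sphere is smoothed after extending it radially to the complement of the origin.

The colimit `X` of the `X n` carries the diffeology of local lifts to some `X n`, and its D-topology
is the colimit of their D-topologies (`DiffSpace.exists_isSeqColimit`). Since the sequences start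
with empty spaces, its `n`-skeleton as a smooth CW complex is `X (n + 1)`. That `Y` is
delta-generated follows from the universal properties of the attachments and of the colimit, as
disks are delta-generated.
-/

noncomputable section

open Set Filter Topology
open scoped ContDiff unitInterval

/-! ### Germs of plots -/

/-- The coordinate space `ℝⁿ` on which plots are defined. -/
abbrev Coord (n : ℕ) : Type := EuclideanSpace ℝ (Fin n)

/-- Every neighbourhood of a point of `ℝⁿ` receives a smooth map from all of `ℝⁿ` which is the
identity near the point. This turns local data on `ℝⁿ` into global data with the same germ. -/
lemma exists_contDiff_eventuallyEq_id {n : ℕ} {x : Coord n} {U : Set (Coord n)} (hU : U ∈ 𝓝 x) :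
    ∃ s : Coord n → Coord n, ContDiff ℝ ∞ s ∧ s =ᶠ[𝓝 x] id ∧ ∀ y, s y ∈ U := by
  obtain ⟨r, hr, hrU⟩ := Metric.mem_nhds_iff.1 hU
  let f : ContDiffBump x := ⟨r / 3, r / 2, by positivity, by linarith⟩
  refine ⟨fun y ↦ x + f y • (y - x), ?_, ?_, fun y ↦ hrU ?_⟩
  · have : ContDiff ℝ ∞ (fun y ↦ f y) := f.contDiff
    fun_prop
  · filter_upwards [f.eventuallyEq_one] with y hy
    simp [hy]
  · rw [Metric.mem_ball, dist_eq_norm, add_sub_cancel_left, norm_smul, Real.norm_eq_abs,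
      abs_of_nonneg f.nonneg]
    by_cases hy : dist y x < f.rOut
    · rw [dist_eq_norm] at hy
      have h1 : f y ≤ 1 := f.le_one
      have h2 : ‖y - x‖ < r / 2 := hy
      nlinarith [norm_nonneg (y - x), f.nonneg (x := y)]
    · rw [f.zero_of_le_dist (not_lt.1 hy)]
      simpa using hr

/-- A map on `ℝⁿ` is a plot at `x` if it agrees near `x` with a plot. -/
def PlotAt {n : ℕ} {X : Type*} [DiffeologicalSpace X] (f : Coord n → X) (x : Coord n) : Prop :=
  ∃ g : Coord n → X, IsPlot g ∧ f =ᶠ[𝓝 x] g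

section PlotAt

variable {n k : ℕ} {X Y : Type*} [DiffeologicalSpace X] [DiffeologicalSpace Y]
  {f g : Coord n → X} {x : Coord n}

lemma Diffeology.IsPlot.plotAt (hf : IsPlot f) (x : Coord n) : PlotAt f x := ⟨f, hf, .rfl⟩

lemma PlotAt.congr (hf : PlotAt f x) (h : g =ᶠ[𝓝 x] f) : PlotAt g x := by
  obtain ⟨p, hp, hfp⟩ := hf
  exact ⟨p, hp, h.trans hfp⟩

lemma PlotAt.dSmooth {φ : X → Y} (hφ : DSmooth φ) (hf : PlotAt f x) :
    PlotAt (fun y ↦ φ (f y)) x := by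
  obtain ⟨p, hp, hfp⟩ := hf
  exact ⟨φ ∘ p, hφ _ _ hp, hfp.fun_comp φ⟩

lemma PlotAt.comp_contDiff {q : Coord k → Coord n} (hq : ContDiff ℝ ∞ q) {y : Coord k}
    (hf : PlotAt f (q y)) : PlotAt (fun z ↦ f (q z)) y := by
  obtain ⟨p, hp, hfp⟩ := hf
  exact ⟨p ∘ q, isPlot_reparam hp hq, (hq.continuous.tendsto y).eventually hfp⟩

lemma isPlot_iff_plotAt : IsPlot f ↔ ∀ x, PlotAt f x := by
  refine ⟨fun h ↦ h.plotAt, fun h ↦ DiffeologicalSpace.locality fun x ↦ ?_⟩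
  obtain ⟨g, hg, hfg⟩ := h x
  obtain ⟨U, hU, hUo, hxU⟩ := eventually_nhds_iff.1 hfg
  refine ⟨U, hUo, hxU, fun {m q} hq hqs ↦ ?_⟩
  have : f ∘ q = g ∘ q := funext fun y ↦ hU _ (hq y)
  rw [this]
  exact isPlot_reparam hg hqs

lemma PlotAt.exists_contDiff_comp (hf : PlotAt f x) :
    ∃ s : Coord n → Coord n, ContDiff ℝ ∞ s ∧ s =ᶠ[𝓝 x] id ∧ IsPlot (f ∘ s) := by
  obtain ⟨g, hg, hfg⟩ := hf
  obtain ⟨s, hs, hsx, hsU⟩ := exists_contDiff_eventuallyEq_id hfg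
  refine ⟨s, hs, hsx, ?_⟩
  have : f ∘ s = g ∘ s := funext fun y ↦ hsU y
  rw [this]
  exact isPlot_reparam hg hs

lemma PlotAt.of_comp {s : Coord n → Coord n} (hs : s =ᶠ[𝓝 x] id)
    (h : IsPlot (f ∘ s)) : PlotAt f x :=
  ⟨f ∘ s, h, hs.mono fun y hy ↦ by simp [show s y = y from hy]⟩

lemma PlotAt.continuousAt (hf : PlotAt f x) :
    letI : TopologicalSpace X := dTopology
    ContinuousAt f x := by
  let _ : TopologicalSpace X := dTopology
  obtain ⟨g, hg, hfg⟩ := hf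
  exact hg.continuous.continuousAt.congr hfg.symm

variable {F : Type*} [NormedAddCommGroup F] [NormedSpace ℝ F] [DiffeologicalSpace F]
  [IsContDiffCompatible F] {G : Type*} [NormedAddCommGroup G] [NormedSpace ℝ G]
  [DiffeologicalSpace G] [IsContDiffCompatible G]
  {H : Type*} [NormedAddCommGroup H] [NormedSpace ℝ H]
  [DiffeologicalSpace H] [IsContDiffCompatible H]

lemma ContDiffOn.plotAt {f : Coord n → F} {U : Set (Coord n)} (hf : ContDiffOn ℝ ∞ f U)
    (hU : U ∈ 𝓝 x) : PlotAt f x := by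
  obtain ⟨s, hs, hsx, hsU⟩ := exists_contDiff_eventuallyEq_id hU
  exact PlotAt.of_comp hsx (hf.comp_contDiff hs hsU).isPlot

lemma PlotAt.continuousAt_normed {f : Coord n → F} (hf : PlotAt f x) : ContinuousAt f x := by
  obtain ⟨g, hg, hfg⟩ := hf
  exact hg.contDiff.continuous.continuousAt.congr hfg.symm

lemma PlotAt.contDiff_comp₂ {φ : F × G → H} (hφ : ContDiff ℝ ∞ φ) {f : Coord n → F}
    {g : Coord n → G} (hf : PlotAt f x) (hg : PlotAt g x) :
    PlotAt (fun y ↦ φ (f y, g y)) x := by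
  obtain ⟨f', hf', hff⟩ := hf
  obtain ⟨g', hg', hgg⟩ := hg
  refine ⟨fun y ↦ φ (f' y, g' y), (hφ.comp (hf'.contDiff.prodMk hg'.contDiff)).isPlot, ?_⟩
  filter_upwards [hff, hgg] with y h1 h2
  simp [h1, h2]

lemma plotAt_inducedBy {X Y : Type*} [DiffeologicalSpace Y] {φ : X → Y} {f : Coord n → X} :
    letI := DiffeologicalSpace.inducedBy φ
    PlotAt f x ↔ PlotAt (φ ∘ f) x := by
  let _ := DiffeologicalSpace.inducedBy φ
  refine ⟨fun ⟨g, hg, hfg⟩ ↦ ⟨φ ∘ g, hg, hfg.fun_comp φ⟩, fun h ↦ ?_⟩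
  obtain ⟨s, hs, hsx, hp⟩ := h.exists_contDiff_comp
  exact PlotAt.of_comp hsx hp

end PlotAt

/-! ### Glued diffeological spaces -/

/-- The diffeology glued from a jointly surjective family of maps out of diffeological spaces:
plots are the maps which locally lift to a plot of a member of the family. -/
@[reducible]
def gluedDiffeology {X : Type u} {J : Type v} (A : J → DiffSpace.{u}) (φ : ∀ j, A j → X)
    (hφ : ∀ x, ∃ j a, φ j a = x) : DiffeologicalSpace X where
  plots n := {p | ∀ x, ∃ j, ∃ g : Coord n → A j, IsPlot g ∧ p =ᶠ[𝓝 x] φ j ∘ g}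
  constant_plots x _ := by
    obtain ⟨j, a, rfl⟩ := hφ x
    exact ⟨j, fun _ ↦ a, isPlot_const, .rfl⟩
  plot_reparam {n m p f} hp hf x := by
    obtain ⟨j, g, hg, hpg⟩ := hp (f x)
    exact ⟨j, g ∘ f, isPlot_reparam hg hf, (hf.continuous.tendsto x).eventually hpg⟩
  locality {n p} h x := by
    obtain ⟨U, hU, hxU, h⟩ := h x
    obtain ⟨s, hs, hsx, hsU⟩ := exists_contDiff_eventuallyEq_id (hU.mem_nhds hxU)
    obtain ⟨j, g, hg, hpg⟩ := h hsU hs x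
    refine ⟨j, g, hg, ?_⟩
    filter_upwards [hsx, hpg] with y h1 h2
    rw [← h2]
    simp [h1]

namespace DiffSpace

/-- Diffeological spaces are topologized by the D-topology. -/
instance instTopologicalSpaceCarrier (X : DiffSpace.{u}) : TopologicalSpace X := dTopology

lemma isOpen_iff {X : DiffSpace.{u}} {U : Set X} :
    IsOpen U ↔ ∀ (n : ℕ) (p : Coord n → X), IsPlot p → IsOpen (p ⁻¹' U) :=
  isOpen_iff_preimages_plots

lemma Hom.continuous {X Y : DiffSpace.{u}} (f : X ⟶ Y) : Continuous f.toFun :=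
  f.smooth.continuous

@[ext] lemma hom_ext {X Y : DiffSpace.{u}} {f g : X ⟶ Y} (h : ∀ x, f.toFun x = g.toFun x) :
    f = g := Hom.ext (funext h)

section glued

variable {X : Type u} {J : Type v} (A : J → DiffSpace.{u}) (φ : ∀ j, A j → X)
    (hφ : ∀ x, ∃ j a, φ j a = x)

/-- The diffeological space glued from a jointly surjective family. -/
def glued : DiffSpace.{u} := letI := gluedDiffeology A φ hφ; .of X

/-- The structure map of a glued diffeological space. -/
def toGlued (j : J) : A j ⟶ glued A φ hφ where
  toFun := φ j
  smooth _ p hp _ := ⟨j, p, hp, .rfl⟩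

variable {A φ hφ}

lemma isPlot_glued {n : ℕ} {p : Coord n → glued A φ hφ} :
    IsPlot p ↔ ∀ x, ∃ j, ∃ g : Coord n → A j, IsPlot g ∧
      p =ᶠ[𝓝 x] fun y ↦ (toGlued A φ hφ j).toFun (g y) := Iff.rfl

lemma dSmooth_glued {Y : Type*} [DiffeologicalSpace Y] {f : glued A φ hφ → Y}
    (hf : ∀ j, DSmooth fun a : A j ↦ f ((toGlued A φ hφ j).toFun a)) : DSmooth f := by
  refine fun n p hp ↦ isPlot_iff_plotAt.2 fun x ↦ ?_
  obtain ⟨j, g, hg, hpg⟩ := isPlot_glued.1 hp x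
  exact ⟨_, hf j _ _ hg, hpg.fun_comp f⟩

lemma isOpen_glued {U : Set (glued A φ hφ)} :
    IsOpen U ↔ ∀ j, IsOpen ((toGlued A φ hφ j).toFun ⁻¹' U) := by
  refine ⟨fun h j ↦ h.preimage (toGlued A φ hφ j).continuous, fun h ↦ isOpen_iff.2
    fun n p hp ↦ isOpen_iff_mem_nhds.2 fun x hx ↦ ?_⟩
  obtain ⟨j, g, hg, hpg⟩ := isPlot_glued.1 hp x
  have hx' : x ∈ g ⁻¹' ((toGlued A φ hφ j).toFun ⁻¹' U) := by
    simpa only [mem_preimage, ← hpg.eq_of_nhds] using hx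
  filter_upwards [(isOpen_iff.1 (h j) _ _ hg).mem_nhds hx', hpg] with y h1 h2
  simpa only [mem_preimage, h2] using h1

lemma continuous_glued {T : Type*} [TopologicalSpace T] {f : glued A φ hφ → T} :
    Continuous f ↔ ∀ j, Continuous fun a : A j ↦ f ((toGlued A φ hφ j).toFun a) := by
  simp only [continuous_def]
  exact ⟨fun h j U hU ↦ isOpen_glued.1 (h U hU) j, fun h U hU ↦ isOpen_glued.2 fun j ↦ h j U hU⟩

end glued

/-! ### Disks and their boundaries -/

/-- The boundary `{x ∈ ℝᵐ | ‖x‖ = 1}` of the `m`-disk, with the subspace diffeology; the sphere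
`Sⁿ` is the case `m = n + 1`. -/
def bdry (m : ℕ) : DiffSpace.{u} :=
  letI := DiffeologicalSpace.inducedBy
    (fun x : ULift.{u} (Metric.sphere (0 : Coord m) 1) ↦ (x.down : Coord m))
  .of (ULift.{u} (Metric.sphere (0 : Coord m) 1))

variable {m : ℕ}

/-- The point of `bdry m` given by a unit vector. -/
def bdry.mk (x : Coord m) (hx : ‖x‖ = 1) : bdry.{u} m := ⟨⟨x, by simpa using hx⟩⟩

/-- The unit vector underlying a point of `bdry m`. -/
def bdryVal (x : bdry.{u} m) : Coord m := x.down.1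

/-- The point of `disk m` given by a vector of norm at most one. -/
def disk.mk (x : Coord m) (hx : ‖x‖ ≤ 1) : disk.{u} m := ⟨⟨x, by simpa using hx⟩⟩

/-- The vector underlying a point of `disk m`. -/
def diskVal (x : disk.{u} m) : Coord m := x.down.1

@[simp] lemma bdry.norm_val (x : bdry.{u} m) : ‖bdryVal x‖ = 1 :=
  mem_sphere_zero_iff_norm.1 x.down.2

lemma disk.norm_val_le (x : disk.{u} m) : ‖diskVal x‖ ≤ 1 :=
  mem_closedBall_zero_iff.1 x.down.2

@[simp] lemma disk.val_mk (x : Coord m) (hx : ‖x‖ ≤ 1) : diskVal (disk.mk.{u} x hx) = x := rfl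

lemma disk.ext {x y : disk.{u} m} (h : diskVal x = diskVal y) : x = y :=
  ULift.ext _ _ (Subtype.ext h)

lemma bdry.plotAt_iff {n : ℕ} {p : Coord n → bdry.{u} m} {x : Coord n} :
    PlotAt p x ↔ PlotAt (fun y ↦ bdryVal (p y)) x := plotAt_inducedBy

lemma disk.plotAt_iff {n : ℕ} {p : Coord n → disk.{u} m} {x : Coord n} :
    PlotAt p x ↔ PlotAt (fun y ↦ diskVal (p y)) x := plotAt_inducedBy

lemma bdry.isPlot_iff {n : ℕ} {p : Coord n → bdry.{u} m} :
    IsPlot p ↔ ContDiff ℝ ∞ (fun y ↦ bdryVal (p y)) := Iff.rfl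

lemma disk.isPlot_iff {n : ℕ} {p : Coord n → disk.{u} m} :
    IsPlot p ↔ ContDiff ℝ ∞ (fun y ↦ diskVal (p y)) := Iff.rfl

lemma disk.continuous_val : Continuous (diskVal : disk.{u} m → Coord m) := by
  refine continuous_def.2 fun U hU ↦ isOpen_iff.2 fun n p hp ↦ ?_
  exact hU.preimage (disk.isPlot_iff.1 hp).continuous

/-- The D-topology of the disk is its usual topology: the map `x ↦ 2 x / (1 + ‖x‖²)` is a plot
which sends the closed unit ball homeomorphically to the disk. -/
lemma disk.continuous_mk :
    Continuous fun x : Metric.closedBall (0 : Coord m) 1 ↦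
      disk.mk.{u} x.1 (mem_closedBall_zero_iff.1 x.2) := by
  have hle (x : Coord m) : ‖(2 / (1 + ‖x‖ ^ 2)) • x‖ ≤ 1 := by
    rw [norm_smul, Real.norm_eq_abs, abs_of_pos (by positivity), div_mul_eq_mul_div,
      div_le_one (by positivity)]
    nlinarith [sq_nonneg (1 - ‖x‖)]
  let p : Coord m → disk.{u} m := fun x ↦ disk.mk ((2 / (1 + ‖x‖ ^ 2)) • x) (hle x)
  have hp : IsPlot p := by
    rw [disk.isPlot_iff]
    change ContDiff ℝ ∞ fun x : Coord m ↦ (2 / (1 + ‖x‖ ^ 2)) • x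
    refine (contDiff_const.div (contDiff_const.add (contDiff_norm_sq ℝ)) fun x ↦ ?_).smul
      contDiff_id
    positivity
  -- the inverse of the restriction of the plot to the unit ball
  have hq : Continuous fun x : Metric.closedBall (0 : Coord m) 1 ↦
      (1 / (1 + √(1 - ‖x.1‖ ^ 2))) • x.1 := by
    have h : Continuous fun x : Metric.closedBall (0 : Coord m) 1 ↦ 1 + √(1 - ‖x.1‖ ^ 2) := by
      fun_prop
    refine Continuous.smul (continuous_const.div h fun x ↦ ?_) continuous_subtype_val
    positivity
  refine (Continuous.comp (hp.continuous) hq).congr fun x ↦ disk.ext ?_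
  have hx : ‖x.1‖ ≤ 1 := mem_closedBall_zero_iff.1 x.2
  have h1 : 0 ≤ 1 - ‖x.1‖ ^ 2 := by nlinarith [norm_nonneg x.1]
  have h2 := Real.sq_sqrt h1
  set r := √(1 - ‖x.1‖ ^ 2) with hr
  have hr0 : 0 ≤ r := Real.sqrt_nonneg _
  change (2 / (1 + ‖(1 / (1 + r)) • x.1‖ ^ 2)) • (1 / (1 + r)) • x.1 = x.1
  rw [norm_smul, smul_smul]
  convert one_smul ℝ x.1
  rw [Real.norm_eq_abs, abs_of_pos (by positivity), mul_pow, show ‖x.1‖ ^ 2 = 1 - r ^ 2 by linarith]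
  have h3 : 1 + (1 / (1 + r)) ^ 2 * (1 - r ^ 2) = 2 / (1 + r) := by
    field_simp
    ring
  rw [h3]
  field_simp

lemma disk.continuous_iff {T : Type*} [TopologicalSpace T] {f : disk.{u} m → T} :
    Continuous f ↔ Continuous fun x : Metric.closedBall (0 : Coord m) 1 ↦
      f (disk.mk x.1 (mem_closedBall_zero_iff.1 x.2)) := by
  refine ⟨fun h ↦ h.comp disk.continuous_mk, fun h ↦ ?_⟩
  exact h.comp (disk.continuous_val.subtype_mk fun x ↦ by
    simpa using disk.norm_val_le x)

end DiffSpace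

namespace DiffSpace

variable {m : ℕ}

lemma diskClamp_norm_le (v : Coord m) : ‖(max 1 ‖v‖)⁻¹ • v‖ ≤ 1 := by
  have h : 0 < max 1 ‖v‖ := lt_max_of_lt_left one_pos
  rw [norm_smul, norm_inv, Real.norm_of_nonneg h.le, inv_mul_le_iff₀ h]
  simp

/-- The radial retraction of `ℝᵐ` onto the disk. -/
def diskClamp (v : Coord m) : disk.{u} m := disk.mk ((max 1 ‖v‖)⁻¹ • v) (diskClamp_norm_le v)

lemma diskVal_diskClamp {v : Coord m} (hv : ‖v‖ ≤ 1) : diskVal (diskClamp.{u} v) = v := by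
  simp [diskClamp, max_eq_left hv]

@[simp] lemma diskClamp_diskVal (d : disk.{u} m) : diskClamp (diskVal d) = d :=
  disk.ext (diskVal_diskClamp (disk.norm_val_le d))

lemma continuous_diskClamp : Continuous (diskClamp : Coord m → disk.{u} m) := by
  have h : Continuous fun v : Coord m ↦ (max 1 ‖v‖)⁻¹ • v := by
    refine Continuous.smul (Continuous.inv₀ (continuous_const.max continuous_norm) fun v ↦ ?_)
      continuous_id
    exact (lt_max_of_lt_left one_pos).ne'
  exact disk.continuous_mk.comp (h.subtype_mk fun v ↦ by simpa using diskClamp_norm_le v)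

/-- The inclusion of the boundary of the disk. -/
def bdryInclusion (m : ℕ) : bdry.{u} m ⟶ disk.{u} m where
  toFun x := disk.mk (bdryVal x) (bdry.norm_val x).le
  smooth _ _ hp := hp

@[simp] lemma diskVal_bdryInclusion (x : bdry.{u} m) :
    diskVal ((bdryInclusion m).toFun x) = bdryVal x := rfl

/-! ### Attaching disks to a diffeological space -/

section attach

variable {X : DiffSpace.{u}} {ι : Type u} (h : ι → (bdry.{u} m ⟶ X))

/-- The pieces `X` and `disk m`, one for each `α : ι`, from which `attach h` is glued. -/
def attachPiece (X : DiffSpace.{u}) (ι : Type u) (m : ℕ) (o : Option ι) : DiffSpace.{u} :=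
  o.elim X fun _ ↦ disk m

/-- The characteristic map of a cell, on underlying sets: the underlying set of `attach h` is the
disjoint union of `X` and the open cells. -/
def cellFun (α : ι) (d : disk.{u} m) : X ⊕ (ι × Metric.ball (0 : Coord m) 1) :=
  if hd : ‖diskVal d‖ < 1 then .inr (α, ⟨diskVal d, by simpa using hd⟩)
  else .inl ((h α).toFun (bdry.mk (diskVal d) (le_antisymm (disk.norm_val_le d) (not_lt.1 hd))))

/-- The maps from the pieces of `attach h` to its underlying set. -/
def attachFun : ∀ o : Option ι, attachPiece X ι m o → X ⊕ (ι × Metric.ball (0 : Coord m) 1)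
  | none => Sum.inl
  | some α => cellFun h α

lemma attachFun_surjective (y : X ⊕ (ι × Metric.ball (0 : Coord m) 1)) :
    ∃ o a, attachFun h o a = y := by
  obtain x | ⟨α, b, hb⟩ := y
  · exact ⟨none, x, rfl⟩
  · have hb' : ‖b‖ < 1 := by simpa using hb
    exact ⟨some α, disk.mk b hb'.le, dif_pos hb'⟩

/-- The space obtained from `X` by attaching `m`-cells along the maps `h α`, as the pushout in
diffeological spaces: plots locally lift to `X` or to one of the closed disks. -/
def attach : DiffSpace.{u} := glued (attachPiece X ι m) (attachFun h) (attachFun_surjective h)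

/-- The inclusion of `X` in the space obtained from it by attaching cells. -/
def attachIncl : X ⟶ attach h := toGlued (attachPiece X ι m) _ (attachFun_surjective h) none

/-- The characteristic map of a cell. -/
def attachCell (α : ι) : disk m ⟶ attach h :=
  toGlued (attachPiece X ι m) _ (attachFun_surjective h) (some α)

variable {h}

lemma attachIncl_injective : Function.Injective (attachIncl h).toFun :=
  Sum.inl_injective

lemma attachCell_bdry (α : ι) (x : bdry.{u} m) :
    (attachCell h α).toFun ((bdryInclusion m).toFun x) = (attachIncl h).toFun ((h α).toFun x) :=
  dif_neg (by simp)

lemma attachCell_of_norm_eq_one (α : ι) (d : disk.{u} m) (hd : ‖diskVal d‖ = 1) :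
    (attachCell h α).toFun d = (attachIncl h).toFun ((h α).toFun (bdry.mk (diskVal d) hd)) :=
  attachCell_bdry α (bdry.mk (diskVal d) hd)

lemma attach_cases (y : attach h) : (∃ x, y = (attachIncl h).toFun x) ∨
    ∃ α d, ‖diskVal d‖ < 1 ∧ y = (attachCell h α).toFun d := by
  obtain x | ⟨α, b, hb⟩ := y
  · exact .inl ⟨x, rfl⟩
  · have hb' : ‖b‖ < 1 := by simpa using hb
    exact .inr ⟨α, disk.mk b hb'.le, hb', (dif_pos hb' : cellFun h α (disk.mk b hb'.le) = _).symm⟩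

variable {T : Type*}

variable (h) in
/-- The map out of `attach h` which is `f` on `X` and `g α` on the open cell `α`. -/
def attachDesc (f : X → T) (g : ι → disk.{u} m → T) : attach h → T :=
  Sum.elim f fun p ↦ g p.1 (disk.mk p.2.1 (by simpa using (mem_ball_zero_iff.1 p.2.2).le))

variable {f : X → T} {g : ι → disk.{u} m → T}

@[simp] lemma attachDesc_incl (x : X) : attachDesc h f g ((attachIncl h).toFun x) = f x := rfl

lemma attachDesc_cell_of_lt (α : ι) (d : disk.{u} m) (hd : ‖diskVal d‖ < 1) :
    attachDesc h f g ((attachCell h α).toFun d) = g α d := by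
  have : (attachCell h α).toFun d = cellFun h α d := rfl
  rw [this, cellFun, dif_pos hd]
  rfl

lemma attachDesc_cell (hfg : ∀ α x, g α ((bdryInclusion m).toFun x) = f ((h α).toFun x))
    (α : ι) (d : disk.{u} m) : attachDesc h f g ((attachCell h α).toFun d) = g α d := by
  obtain hd | hd := (disk.norm_val_le d).lt_or_eq
  · exact attachDesc_cell_of_lt α d hd
  · rw [attachCell_of_norm_eq_one α d hd, attachDesc_incl, ← hfg]
    rfl

lemma isPlot_attach {n : ℕ} {p : Coord n → attach h} : IsPlot p ↔ ∀ x,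
    (∃ g : Coord n → X, IsPlot g ∧ p =ᶠ[𝓝 x] fun y ↦ (attachIncl h).toFun (g y)) ∨
    ∃ α, ∃ g : Coord n → disk m, IsPlot g ∧ p =ᶠ[𝓝 x] fun y ↦ (attachCell h α).toFun (g y) := by
  refine isPlot_glued.trans (forall_congr' fun x ↦ ?_)
  rw [Option.exists]
  rfl

lemma plotAt_attach_cases {n : ℕ} {p : Coord n → attach h} {x : Coord n} (hp : PlotAt p x) :
    (∃ g : Coord n → X, IsPlot g ∧ p =ᶠ[𝓝 x] fun y ↦ (attachIncl h).toFun (g y)) ∨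
    ∃ α, ∃ g : Coord n → disk m, IsPlot g ∧
      p =ᶠ[𝓝 x] fun y ↦ (attachCell h α).toFun (g y) := by
  obtain ⟨q, hq, hpq⟩ := hp
  obtain ⟨g, hg, hqg⟩ | ⟨α, g, hg, hqg⟩ := isPlot_attach.1 hq x
  · exact .inl ⟨g, hg, hpq.trans hqg⟩
  · exact .inr ⟨α, g, hg, hpq.trans hqg⟩

lemma dSmooth_attach [DiffeologicalSpace T] {φ : attach h → T}
    (hf : DSmooth fun x ↦ φ ((attachIncl h).toFun x))
    (hg : ∀ α, DSmooth fun d ↦ φ ((attachCell h α).toFun d)) : DSmooth φ :=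
  dSmooth_glued (Option.forall.2 ⟨hf, hg⟩)

lemma continuous_attach [TopologicalSpace T] {φ : attach h → T}
    (hf : Continuous fun x ↦ φ ((attachIncl h).toFun x))
    (hg : ∀ α, Continuous fun d ↦ φ ((attachCell h α).toFun d)) : Continuous φ :=
  continuous_glued.2 (Option.forall.2 ⟨hf, hg⟩)

lemma isOpen_attach {U : Set (attach h)} :
    IsOpen U ↔ IsOpen ((attachIncl h).toFun ⁻¹' U) ∧
      ∀ α, IsOpen ((attachCell h α).toFun ⁻¹' U) :=
  isOpen_glued.trans Option.forall

/-! ### Radial coordinates -/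

variable (h) in
/-- The radius of a point of `attach h`: the norm on cells, and `1` on `X`. -/
def rad : attach h → ℝ := attachDesc h (fun _ ↦ 1) fun _ d ↦ ‖diskVal d‖

@[simp] lemma rad_incl (x : X) : rad h ((attachIncl h).toFun x) = 1 := rfl

@[simp] lemma rad_cell (α : ι) (d : disk.{u} m) : rad h ((attachCell h α).toFun d) = ‖diskVal d‖ :=
  attachDesc_cell (by simp) _ _

lemma continuous_rad : Continuous (rad h) :=
  continuous_attach continuous_const fun α ↦ by
    simpa only [rad_cell] using disk.continuous_val.norm

variable (h) in
/-- The vector underlying a point of an open cell of `attach h`. It is `0` on `X`, where the factor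
`(1 - rad h y)⁻¹` has the junk value `0`; the remaining factor is continuous on all of
`attach h`. -/
def vec (y : attach h) : Coord m :=
  (1 - rad h y)⁻¹ • attachDesc h (fun _ ↦ 0) (fun _ d ↦ (1 - ‖diskVal d‖) • diskVal d) y

lemma vec_cell (α : ι) (d : disk.{u} m) (hd : ‖diskVal d‖ < 1) :
    vec h ((attachCell h α).toFun d) = diskVal d := by
  rw [vec, rad_cell, attachDesc_cell_of_lt _ _ hd, inv_smul_smul₀ (by linarith)]

lemma continuousAt_vec {y : attach h} (hy : rad h y < 1) : ContinuousAt (vec h) y := by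
  have h1 : ContinuousAt (fun y ↦ 1 - rad h y) y :=
    (continuous_const.sub continuous_rad).continuousAt
  refine (h1.inv₀ (by linarith)).smul (Continuous.continuousAt ?_)
  refine continuous_attach continuous_const fun α ↦ ?_
  simp only [attachDesc_cell (h := h) (f := fun _ ↦ (0 : Coord m))
    (g := fun _ d ↦ (1 - ‖diskVal d‖) • diskVal d) (by simp)]
  have := disk.continuous_val.{u} (m := m)
  fun_prop

lemma norm_vec {y : attach h} (hy : rad h y < 1) : ‖vec h y‖ = rad h y := by
  obtain ⟨x, rfl⟩ | ⟨α, d, hd, rfl⟩ := attach_cases y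
  · simp at hy
  · rw [vec_cell α d hd, rad_cell]

open Classical in
lemma isOpen_openCell (α : ι) :
    IsOpen {y : attach h | ∃ d, ‖diskVal d‖ < 1 ∧ y = (attachCell h α).toFun d} := by
  let ψ : attach h → ℝ := attachDesc h (fun _ ↦ 0) fun β d ↦ if β = α then 1 - ‖diskVal d‖ else 0
  have hψ : Continuous ψ := by
    refine continuous_attach continuous_const fun β ↦ ?_
    simp only [ψ]
    simp only [attachDesc_cell (h := h) (f := fun _ ↦ (0 : ℝ))
      (g := fun β d ↦ if β = α then 1 - ‖diskVal d‖ else 0) (by simp)]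
    have := disk.continuous_val.{u} (m := m)
    split_ifs <;> fun_prop
  convert isOpen_lt continuous_const hψ (f := fun _ ↦ (0 : ℝ)) using 1
  ext y
  constructor
  · rintro ⟨d, hd, rfl⟩
    change 0 < ψ _
    rw [show ψ _ = _ from attachDesc_cell_of_lt α d hd]
    simpa using hd
  · intro hy
    obtain ⟨x, rfl⟩ | ⟨β, d, hd, rfl⟩ := attach_cases y
    · exact absurd hy (lt_irrefl (0 : ℝ))
    · change 0 < ψ _ at hy
      rw [show ψ _ = _ from attachDesc_cell_of_lt β d hd] at hy
      by_cases hβ : β = α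
      · exact ⟨d, hd, by rw [hβ]⟩
      · simp [hβ] at hy

/-- Near a point of an open cell, points are given by their underlying vector. -/
lemma eventually_eq_cell {y : attach h} (hy : rad h y < 1) :
    ∃ α, ∀ᶠ z in 𝓝 y, rad h z < 1 ∧ z = (attachCell h α).toFun (diskClamp (vec h z)) := by
  obtain ⟨x, rfl⟩ | ⟨α, d, hd, rfl⟩ := attach_cases y
  · simp at hy
  · refine ⟨α, ?_⟩
    filter_upwards [(isOpen_openCell α).mem_nhds ⟨d, hd, rfl⟩]
    rintro z ⟨d', hd', rfl⟩
    rw [vec_cell α d' hd', diskClamp_diskVal, rad_cell]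
    exact ⟨hd', rfl⟩

lemma plotAt_vec {n : ℕ} {p : Coord n → attach h} {x : Coord n} (hp : PlotAt p x)
    (hx : rad h (p x) < 1) : PlotAt (fun y ↦ vec h (p y)) x := by
  have hlt : ∀ᶠ y in 𝓝 x, rad h (p y) < 1 :=
    (continuous_rad.continuousAt.comp hp.continuousAt).eventually (gt_mem_nhds hx)
  obtain ⟨g, hg, hpg⟩ | ⟨α, g, hg, hpg⟩ := plotAt_attach_cases hp
  · rw [hpg.eq_of_nhds, rad_incl] at hx
    exact absurd hx (lt_irrefl _)
  · refine (disk.plotAt_iff.1 (hg.plotAt x)).congr ?_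
    filter_upwards [hpg, hlt] with y h1 h2
    rw [h1, rad_cell] at h2
    rw [h1, vec_cell _ _ h2]

lemma plotAt_of_vec {n : ℕ} {p : Coord n → attach h} {x : Coord n} (hc : ContinuousAt p x)
    (hx : rad h (p x) < 1) (hp : PlotAt (fun y ↦ vec h (p y)) x) : PlotAt p x := by
  obtain ⟨α, hα⟩ := eventually_eq_cell hx
  have hα := hc.eventually hα
  have : PlotAt (fun y ↦ diskClamp.{u} (vec h (p y))) x := by
    refine disk.plotAt_iff.2 (hp.congr ?_)
    filter_upwards [hα] with y hy
    rw [diskVal_diskClamp (by rw [norm_vec hy.1]; exact hy.1.le)]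
  refine (this.dSmooth (attachCell h α).smooth).congr ?_
  filter_upwards [hα] with y hy using hy.2

/-! ### Moving points within their cells -/

variable (h) in
/-- The translation of a point of an open cell by a vector, cut off at the boundary. Points of `X`
do not move. -/
def shift (y : attach h) (w : Coord m) : attach h :=
  attachDesc h (attachIncl h).toFun (fun α d ↦ (attachCell h α).toFun (diskClamp (diskVal d + w))) y

lemma shift_incl (x : X) (w : Coord m) :
    shift h ((attachIncl h).toFun x) w = (attachIncl h).toFun x := rfl

lemma shift_cell (α : ι) (d : disk.{u} m) (hd : ‖diskVal d‖ < 1) (w : Coord m) :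
    shift h ((attachCell h α).toFun d) w =
      (attachCell h α).toFun (diskClamp (diskVal d + w)) := attachDesc_cell_of_lt _ _ hd

@[simp] lemma shift_zero (y : attach h) : shift h y 0 = y := by
  obtain ⟨x, rfl⟩ | ⟨α, d, hd, rfl⟩ := attach_cases y
  · rfl
  · rw [shift_cell α d hd, add_zero, diskClamp_diskVal]

lemma vec_shift {y : attach h} (hy : rad h y < 1) {w : Coord m} (hw : ‖vec h y + w‖ < 1) :
    rad h (shift h y w) < 1 ∧ vec h (shift h y w) = vec h y + w := by
  obtain ⟨x, rfl⟩ | ⟨α, d, hd, rfl⟩ := attach_cases y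
  · simp at hy
  · rw [vec_cell α d hd] at hw
    have hw' := diskVal_diskClamp.{u} hw.le
    rw [shift_cell α d hd, vec_cell _ _ (by rwa [hw']), rad_cell, hw', vec_cell α d hd]
    exact ⟨hw, rfl⟩

lemma continuousAt_shift {y : attach h} (hy : rad h y < 1) (w : Coord m) :
    ContinuousAt (fun q : attach h × Coord m ↦ shift h q.1 q.2) (y, w) := by
  obtain ⟨α, hα⟩ := eventually_eq_cell hy
  have h1 : ContinuousAt (fun q : attach h × Coord m ↦
      (attachCell h α).toFun (diskClamp (vec h q.1 + q.2))) (y, w) := by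
    refine ((attachCell h α).continuous.comp continuous_diskClamp).continuousAt.comp ?_
    exact (ContinuousAt.comp (x := (y, w)) (g := vec h) (continuousAt_vec hy) continuousAt_fst).add
      continuousAt_snd
  refine h1.congr ?_
  filter_upwards [continuousAt_fst.eventually hα] with q hq
  have h2 : diskVal (diskClamp.{u} (vec h q.1)) = vec h q.1 :=
    diskVal_diskClamp (by rw [norm_vec hq.1]; exact hq.1.le)
  conv_rhs => rw [hq.2, shift_cell _ _ (by rw [h2, norm_vec hq.1]; exact hq.1), h2]

/-! ### Pushing collars to the boundary -/

/-- The profile of the radial push: a smooth function of the squared norm `t` which is `1 / √t - 1`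
for `1 / 4 ≤ t` and `0` for `t ≤ 1 / 16`. -/
def pushProfile (t : ℝ) : ℝ := Real.smoothTransition (16 / 3 * (t - 1 / 16)) * ((√t)⁻¹ - 1)

lemma contDiff_pushProfile : ContDiff ℝ ∞ pushProfile := by
  refine contDiff_iff_contDiffAt.2 fun t ↦ ?_
  obtain ht | ht := lt_or_ge t (1 / 16)
  · refine (contDiffAt_const (c := 0)).congr_of_eventuallyEq ?_
    filter_upwards [gt_mem_nhds ht] with s hs
    rw [pushProfile, Real.smoothTransition.zero_of_nonpos (by linarith), zero_mul]
  · have h1 : ContDiffAt ℝ ∞ (fun t : ℝ ↦ (√t)⁻¹ - 1) t :=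
      ((contDiffAt_id.sqrt (by simp only [id]; linarith)).inv
        (Real.sqrt_ne_zero'.2 (by simp only [id]; linarith))).sub contDiffAt_const
    have h2 : ContDiff ℝ ∞ (fun t : ℝ ↦ Real.smoothTransition (16 / 3 * (t - 1 / 16))) :=
      Real.smoothTransition.contDiff.comp (by fun_prop)
    exact h2.contDiffAt.mul h1

/-- The radial push of `ℝᵐ` at time `s`: for `s = 1` it sends the collar `1 / 2 ≤ ‖b‖` of the disk
to the boundary. -/
def pushVec (s : ℝ) (b : Coord m) : Coord m := (1 + s * pushProfile (‖b‖ ^ 2)) • b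

@[simp] lemma pushVec_zero (b : Coord m) : pushVec 0 b = b := by simp [pushVec]

lemma pushVec_of_norm_eq_one (s : ℝ) {b : Coord m} (hb : ‖b‖ = 1) : pushVec s b = b := by
  simp [pushVec, pushProfile, hb]

lemma pushVec_one {b : Coord m} (hb : 1 / 2 ≤ ‖b‖) : pushVec 1 b = ‖b‖⁻¹ • b := by
  rw [pushVec, pushProfile, Real.smoothTransition.one_of_one_le (by nlinarith),
    Real.sqrt_sq (norm_nonneg b)]
  congr 1
  ring

lemma norm_pushVec_le {s : ℝ} (hs : s ∈ Icc (0 : ℝ) 1) {b : Coord m} (hb : ‖b‖ ≤ 1) :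
    ‖pushVec s b‖ ≤ 1 := by
  rw [pushVec, pushProfile, Real.sqrt_sq (norm_nonneg b), norm_smul]
  set χ := Real.smoothTransition (16 / 3 * (‖b‖ ^ 2 - 1 / 16))
  have h0 : 0 ≤ χ := Real.smoothTransition.nonneg _
  have h1 : χ ≤ 1 := Real.smoothTransition.le_one _
  obtain hb0 | hb0 := (norm_nonneg b).eq_or_lt
  · rw [← hb0]
    simp
  · have h2 : 0 ≤ ‖b‖⁻¹ - 1 := sub_nonneg.2 ((one_le_inv₀ hb0).2 hb)
    rw [Real.norm_of_nonneg (by have := mul_nonneg hs.1 (mul_nonneg h0 h2); linarith)]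
    have h3 : s * χ ≤ 1 := mul_le_one₀ hs.2 h0 h1
    calc (1 + s * (χ * (‖b‖⁻¹ - 1))) * ‖b‖ = ‖b‖ + (s * χ) * (1 - ‖b‖) := by field_simp
      _ ≤ ‖b‖ + 1 * (1 - ‖b‖) := by gcongr
      _ = 1 := by ring

lemma contDiff_pushVec : ContDiff ℝ ∞ fun q : ℝ × Coord m ↦ pushVec q.1 q.2 := by
  unfold pushVec
  have h1 : ContDiff ℝ ∞ fun q : ℝ × Coord m ↦ pushProfile (‖q.2‖ ^ 2) :=
    contDiff_pushProfile.comp (contDiff_snd.norm_sq ℝ)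
  fun_prop

variable (h) in
/-- The radial push at time `s`. At time `1`, it sends a collar of `X` into `X`. -/
def push (s : ℝ) : attach h → attach h :=
  attachDesc h (attachIncl h).toFun
    fun α d ↦ (attachCell h α).toFun (diskClamp (pushVec s (diskVal d)))

@[simp] lemma push_incl (s : ℝ) (x : X) :
    push h s ((attachIncl h).toFun x) = (attachIncl h).toFun x := rfl

@[simp] lemma push_cell (s : ℝ) (α : ι) (d : disk.{u} m) :
    push h s ((attachCell h α).toFun d) =
      (attachCell h α).toFun (diskClamp (pushVec s (diskVal d))) := by
  refine attachDesc_cell (fun α x ↦ ?_) α d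
  rw [← attachCell_bdry, diskVal_bdryInclusion, pushVec_of_norm_eq_one s (bdry.norm_val x)]
  exact congrArg _ (diskClamp_diskVal ((bdryInclusion m).toFun x))

lemma push_zero (y : attach h) : push h 0 y = y := by
  obtain ⟨x, rfl⟩ | ⟨α, d, hd, rfl⟩ := attach_cases y
  · rfl
  · rw [push_cell, pushVec_zero, diskClamp_diskVal]

lemma continuous_push : Continuous fun q : ℝ × attach h ↦ push h q.1 q.2 := by
  have h1 (y : attach h) : Continuous fun s ↦ push h s y := by
    obtain ⟨x, rfl⟩ | ⟨α, d, hd, rfl⟩ := attach_cases y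
    · exact continuous_const
    · simp only [push_cell]
      have h2 : Continuous fun s : ℝ ↦ pushVec s (diskVal d) :=
        contDiff_pushVec.continuous.comp (Continuous.prodMk_left _)
      exact (attachCell h α).continuous.comp (continuous_diskClamp.comp h2)
  -- `ℝ` is locally compact, so the map may be curried, and tested on `X` and on the disks
  let F : attach h → C(ℝ, attach h) := fun y ↦ ⟨fun s ↦ push h s y, h1 y⟩
  have hF : Continuous F := by
    refine continuous_attach ?_ fun α ↦ ?_
    · exact ContinuousMap.continuous_of_continuous_uncurry _
        ((attachIncl h).continuous.comp continuous_fst)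
    · refine ContinuousMap.continuous_of_continuous_uncurry _ ?_
      change Continuous fun q : disk m × ℝ ↦ push h q.2 ((attachCell h α).toFun q.1)
      simp only [push_cell]
      refine (attachCell h α).continuous.comp (continuous_diskClamp.comp ?_)
      exact contDiff_pushVec.continuous.comp
        (continuous_snd.prodMk (disk.continuous_val.comp continuous_fst))
  exact (hF.comp continuous_snd).eval continuous_fst

lemma plotAt_push {n : ℕ} {p : Coord n → attach h} {l : Coord n → ℝ} {x : Coord n}
    (hp : PlotAt p x) (hl : PlotAt l x) (hl01 : ∀ y, l y ∈ Icc (0 : ℝ) 1) :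
    PlotAt (fun y ↦ push h (l y) (p y)) x := by
  obtain ⟨g, hg, hpg⟩ | ⟨α, g, hg, hpg⟩ := plotAt_attach_cases hp
  · refine ⟨_, (attachIncl h).smooth _ _ hg, ?_⟩
    filter_upwards [hpg] with y hy
    rw [hy, push_incl]
    rfl
  · have h1 : PlotAt (fun y ↦ pushVec (l y) (diskVal (g y))) x :=
      PlotAt.contDiff_comp₂ contDiff_pushVec hl (disk.plotAt_iff.1 (hg.plotAt x))
    have h2 : PlotAt (fun y ↦ diskClamp.{u} (pushVec (l y) (diskVal (g y)))) x := by
      rw [disk.plotAt_iff]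
      simpa only [diskVal_diskClamp (norm_pushVec_le (hl01 _) (disk.norm_val_le _))] using h1
    refine (h2.dSmooth (attachCell h α).smooth).congr ?_
    filter_upwards [hpg] with y hy
    rw [hy, push_cell]

/-- At time `1`, the push sends a point of the collar in a cell to the image of its radial
projection under the attaching map. -/
lemma push_one_cell (α : ι) (d : disk.{u} m) (hd : 1 / 2 < ‖diskVal d‖) (x : bdry.{u} m)
    (hx : bdryVal x = ‖diskVal d‖⁻¹ • diskVal d) :
    push h 1 ((attachCell h α).toFun d) = (attachIncl h).toFun ((h α).toFun x) := by
  rw [push_cell, pushVec_one hd.le, ← hx, ← attachCell_bdry]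
  exact congrArg _ (diskClamp_diskVal ((bdryInclusion m).toFun x))

lemma exists_bdryVal_eq {v : Coord m} (hv : v ≠ 0) : ∃ x : bdry.{u} m, bdryVal x = ‖v‖⁻¹ • v :=
  ⟨bdry.mk _ (norm_smul_inv_norm (𝕜 := ℝ) hv), rfl⟩

lemma exists_push_one {y : attach h} (hy : 1 / 2 < rad h y) :
    ∃ x, push h 1 y = (attachIncl h).toFun x := by
  obtain ⟨x, rfl⟩ | ⟨α, d, hd, rfl⟩ := attach_cases y
  · exact ⟨x, rfl⟩
  · rw [rad_cell] at hy
    obtain ⟨x, hx⟩ := exists_bdryVal_eq.{u} (norm_pos_iff.1 (lt_trans (by norm_num) hy))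
    exact ⟨_, push_one_cell α d hy x hx⟩

/-- The D-topology of `X` is the subspace topology of `attach h`: an open set of `X` is extended
radially over the collars. -/
lemma isInducing_attachIncl : IsInducing (attachIncl h).toFun := by
  refine ⟨le_antisymm (attachIncl h).continuous.le_induced fun U hU ↦ ?_⟩
  refine ⟨{y | 1 / 2 < rad h y ∧ push h 1 y ∈ (attachIncl h).toFun '' U}, ?_, ?_⟩
  · refine isOpen_attach.2 ⟨?_, fun α ↦ ?_⟩
    · convert hU
      ext x
      simp only [mem_preimage, mem_ofPred_eq, rad_incl, push_incl,
        attachIncl_injective.mem_set_image]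
      norm_num
    · refine isOpen_iff.2 fun n q hq ↦ isOpen_iff_mem_nhds.2 fun x hx ↦ ?_
      simp only [mem_preimage, mem_ofPred_eq, rad_cell] at hx
      have hv : ContDiff ℝ ∞ fun y ↦ diskVal (q y) := disk.isPlot_iff.1 hq
      have hx0 : ∀ᶠ y in 𝓝 x, 1 / 2 < ‖diskVal (q y)‖ :=
        hv.continuous.norm.continuousAt.eventually (lt_mem_nhds hx.1)
      have hne {y} (hy : 1 / 2 < ‖diskVal (q y)‖) : diskVal (q y) ≠ 0 :=
        norm_pos_iff.1 (lt_trans (by norm_num) hy)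
      -- the radial projection to the boundary is a plot near `x`
      have : ∃ r : Coord n → bdry.{u} m, ∀ y, 1 / 2 < ‖diskVal (q y)‖ →
          bdryVal (r y) = ‖diskVal (q y)‖⁻¹ • diskVal (q y) := by
        have (y : Coord n) : ∃ r : bdry.{u} m, 1 / 2 < ‖diskVal (q y)‖ →
            bdryVal r = ‖diskVal (q y)‖⁻¹ • diskVal (q y) := by
          by_cases hy : 1 / 2 < ‖diskVal (q y)‖
          · obtain ⟨r, hr⟩ := exists_bdryVal_eq.{u} (hne hy)
            exact ⟨r, fun _ ↦ hr⟩
          · obtain ⟨r, hr⟩ := exists_bdryVal_eq.{u} (hne hx.1)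
            exact ⟨r, fun h ↦ absurd h hy⟩
        exact ⟨fun y ↦ (this y).choose, fun y ↦ (this y).choose_spec⟩
      obtain ⟨r, hr⟩ := this
      have hrx : PlotAt r x := by
        rw [bdry.plotAt_iff]
        have h1 : ContDiffOn ℝ ∞ (fun y ↦ ‖diskVal (q y)‖⁻¹ • diskVal (q y))
            {y | 1 / 2 < ‖diskVal (q y)‖} :=
          fun y hy ↦ (((hv.contDiffAt.norm ℝ (hne hy)).inv (norm_ne_zero_iff.2 (hne hy))).smul
            hv.contDiffAt).contDiffWithinAt
        exact (h1.plotAt hx0).congr (hx0.mono fun y hy ↦ hr y hy)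
      have hUx : ∀ᶠ y in 𝓝 x, (h α).toFun (r y) ∈ U := by
        refine ((h α).continuous.continuousAt.comp hrx.continuousAt).eventually
          (hU.mem_nhds ?_)
        have := hx.2
        rwa [push_one_cell α _ hx.1 _ (hr x hx.1), attachIncl_injective.mem_set_image] at this
      filter_upwards [hx0, hUx] with y h1 h2
      simp only [mem_preimage, mem_ofPred_eq, rad_cell]
      refine ⟨h1, ?_⟩
      rw [push_one_cell α _ h1 _ (hr y h1)]
      exact mem_image_of_mem _ h2
  · ext x
    simp only [mem_preimage, mem_ofPred_eq, rad_incl, push_incl, attachIncl_injective.mem_set_image]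
    norm_num

/-- A map to `X` which is a plot of `attach h` is a plot of `X`. -/
lemma plotAt_of_incl {n : ℕ} {p : Coord n → X} {x : Coord n}
    (hp : PlotAt (fun y ↦ (attachIncl h).toFun (p y)) x) : PlotAt p x := by
  obtain ⟨g, hg, hpg⟩ | ⟨α, g, hg, hpg⟩ := plotAt_attach_cases hp
  · exact ⟨g, hg, hpg.mono fun y hy ↦ attachIncl_injective hy⟩
  · have h1 : ∀ᶠ y in 𝓝 x, ‖diskVal (g y)‖ = 1 := by
      filter_upwards [hpg] with y hy
      rw [← rad_cell (h := h) α (g y), ← hy, rad_incl]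
    obtain ⟨s, hs, hsx, hsU⟩ := exists_contDiff_eventuallyEq_id (h1.and hpg)
    let b : Coord n → bdry.{u} m := fun y ↦ bdry.mk (diskVal (g (s y))) (hsU y).1
    have hgs : IsPlot fun y ↦ g (s y) := isPlot_reparam hg hs
    have hgs' : ContDiff ℝ ∞ fun y ↦ diskVal (g (s y)) := disk.isPlot_iff.1 hgs
    have hb : IsPlot b := bdry.isPlot_iff.2 hgs'
    refine PlotAt.of_comp hsx ?_
    convert (h α).smooth _ _ hb using 1
    funext y
    refine attachIncl_injective ((hsU y).2.trans ?_)
    exact attachCell_of_norm_eq_one α _ (hsU y).1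

end attach

attribute [irreducible] rad vec shift push pushVec diskClamp

end DiffSpace

/-! ### Smooth cutoffs and smooth approximation on open sets -/

lemma exists_plotAt_approx {n m : ℕ} {O : Set (Coord n)} (hO : IsOpen O) {b : Coord n → Coord m}
    (hb : ContinuousOn b O) {ε : ℝ} (hε : 0 < ε) :
    ∃ β : Coord n → Coord m, ∀ x ∈ O, PlotAt β x ∧ ‖β x - b x‖ < ε := by
  classical
  let U : TopologicalSpace.Opens (Coord n) := ⟨O, hO⟩
  have : LocallyCompactSpace U := hO.locallyCompactSpace
  have : SigmaCompactSpace U := sigmaCompactSpace_of_locallyCompact_secondCountable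
  obtain ⟨g, hg, -⟩ := Continuous.exists_contMDiff_approx (M := U)
    (modelWithCornersSelf ℝ (Coord n))
    (f := fun x ↦ b x.1) (ε := fun _ ↦ ε) ⊤ (continuousOn_iff_continuous_domRestrict.1 hb)
    continuous_const (fun _ ↦ hε)
  let β : Coord n → Coord m := fun x ↦ if hx : x ∈ O then g ⟨x, hx⟩ else 0
  have hβ (x : U) : β x.1 = g x := dif_pos x.2
  refine ⟨β, fun x hx ↦ ⟨?_, ?_⟩⟩
  · have h1 : ContDiffOn ℝ ∞ β O := by
      intro y hy
      have h2 : ContMDiffAt (modelWithCornersSelf ℝ (Coord n)) (modelWithCornersSelf ℝ (Coord m)) ∞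
          (fun x : U ↦ β x.1) ⟨y, hy⟩ := by
        simp only [hβ]
        exact g.contMDiff.contMDiffAt
      exact (contMDiffAt_subtype_iff.1 h2).contDiffAt.contDiffWithinAt
    exact h1.plotAt (hO.mem_nhds hx)
  · rw [← dist_eq_norm]
    have := hg ⟨x, hx⟩
    rwa [← hβ] at this

/-- Smooth Urysohn function on an open set `M` of `ℝⁿ`: it is `0` on `A`, which is closed in `M`,
and `1` near each point of `M` outside the neighbourhood `N` of `A`. -/
lemma exists_smooth_cutoff {n : ℕ} {M N A : Set (Coord n)} (hN : IsOpen N)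
    (hAN : A ⊆ N) (hMA : IsOpen (M \ A)) :
    ∃ l : Coord n → ℝ, (∀ x, l x ∈ Icc (0 : ℝ) 1) ∧ (∀ x ∈ M, PlotAt l x) ∧ (∀ x ∈ A, l x = 0) ∧
      ∀ x ∈ M, x ∉ N → ∀ᶠ y in 𝓝 x, l y = 1 := by
  obtain ⟨a, ha, hac, ha01⟩ := hMA.exists_contDiff_support_eq (n := ⊤)
  obtain ⟨b, hb, hbc, hb01⟩ := hN.exists_contDiff_support_eq (n := ⊤)
  have ha0 (x) : 0 ≤ a x := (ha01 (mem_range_self x)).1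
  have hb0 (x) : 0 ≤ b x := (hb01 (mem_range_self x)).1
  have hamem (x) : a x ≠ 0 ↔ x ∈ M \ A := by rw [← ha]; rfl
  have hbmem (x) : b x ≠ 0 ↔ x ∈ N := by rw [← hb]; rfl
  have hpos (x) (hx : x ∈ M) : a x + b x ≠ 0 := by
    by_cases hxA : x ∈ A
    · have := (hb0 x).lt_of_ne' ((hbmem x).2 (hAN hxA))
      have := ha0 x
      positivity
    · have := (ha0 x).lt_of_ne' ((hamem x).2 ⟨hx, hxA⟩)
      have := hb0 x
      positivity
  have hq (x) (hx : x ∈ M) : ContDiffAt ℝ ∞ (fun y ↦ 2 * (a y / (a y + b y))) x :=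
    contDiffAt_const.mul (hac.contDiffAt.div (hac.contDiffAt.add hbc.contDiffAt) (hpos x hx))
  refine ⟨fun x ↦ Real.smoothTransition (2 * (a x / (a x + b x))),
    fun x ↦ ⟨Real.smoothTransition.nonneg _, Real.smoothTransition.le_one _⟩, fun x hx ↦ ?_,
    fun x hx ↦ ?_, fun x hx hxN ↦ ?_⟩
  · have h1 : IsOpen {y | a y + b y ≠ 0} :=
      isOpen_ne.preimage (hac.continuous.add hbc.continuous)
    have h2 : ContDiffOn ℝ ∞ (fun x ↦ Real.smoothTransition (2 * (a x / (a x + b x))))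
        {y | a y + b y ≠ 0} := fun y hy ↦
      (Real.smoothTransition.contDiff.contDiffAt.comp y (contDiffAt_const.mul
        (hac.contDiffAt.div (hac.contDiffAt.add hbc.contDiffAt) hy))).contDiffWithinAt
    exact h2.plotAt (h1.mem_nhds (hpos x hx))
  · have : a x = 0 := by
      by_contra h
      exact ((hamem x).1 h).2 hx
    simp [this]
  · have h1 : b x = 0 := by
      by_contra h
      exact hxN ((hbmem x).1 h)
    have h2 : 1 < 2 * (a x / (a x + b x)) := by
      have := hpos x hx
      rw [h1, add_zero] at this ⊢
      rw [div_self this]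
      norm_num
    filter_upwards [(hq x hx).continuousAt.eventually (lt_mem_nhds h2)] with y hy
    exact Real.smoothTransition.one_of_one_le hy.le

/-! ### Homotopies on open sets of `ℝⁿ` -/

/-- `f` and `g` are homotopic on `M` relative to `A`. The homotopy is parametrized by `ℝ` and
stationary outside the unit interval. -/
def HomotopicOn {n : ℕ} {T : Type*} [TopologicalSpace T] (M A : Set (Coord n))
    (f g : Coord n → T) : Prop :=
  ∃ H : Coord n × ℝ → T, ContinuousOn H (M ×ˢ univ) ∧ ∀ x ∈ M,
    (∀ t ≤ 0, H (x, t) = f x) ∧ (∀ t, 1 ≤ t → H (x, t) = g x) ∧ (x ∈ A → ∀ t, H (x, t) = f x)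

lemma HomotopicOn.trans {n : ℕ} {T : Type*} [TopologicalSpace T] {M A : Set (Coord n)}
    {f g k : Coord n → T} (hfg : HomotopicOn M A f g) (hgk : HomotopicOn M A g k) :
    HomotopicOn M A f k := by
  obtain ⟨H, hH, hHfg⟩ := hfg
  obtain ⟨K, hK, hKgk⟩ := hgk
  refine ⟨fun q ↦ if q.2 ≤ 1 / 2 then H (q.1, 2 * q.2) else K (q.1, 2 * q.2 - 1), ?_,
    fun x hx ↦ ⟨fun t ht ↦ ?_, fun t ht ↦ ?_, fun hxA t ↦ ?_⟩⟩
  · have hH' : ContinuousOn (fun q : Coord n × ℝ ↦ H (q.1, 2 * q.2)) (M ×ˢ univ) :=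
      hH.comp (by fun_prop) fun q hq ↦ ⟨hq.1, trivial⟩
    have hK' : ContinuousOn (fun q : Coord n × ℝ ↦ K (q.1, 2 * q.2 - 1)) (M ×ˢ univ) :=
      hK.comp (by fun_prop) fun q hq ↦ ⟨hq.1, trivial⟩
    refine ContinuousOn.if (fun q hq ↦ ?_) (hH'.mono inter_subset_left)
      (hK'.mono inter_subset_left)
    have h1 : q.2 = 1 / 2 := by
      have := frontier_le_subset_eq continuous_snd continuous_const hq.2
      exact this
    rw [h1, (hHfg q.1 hq.1.1).2.1 _ (by norm_num), (hKgk q.1 hq.1.1).1 _ (by norm_num)]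
  · dsimp only
    rw [if_pos (by linarith), (hHfg x hx).1 _ (by linarith)]
  · dsimp only
    rw [if_neg (by linarith), (hKgk x hx).2.1 _ (by linarith)]
  · dsimp only
    split_ifs with h
    · exact (hHfg x hx).2.2 hxA _
    · rw [(hKgk x hx).2.2 hxA, ← (hHfg x hx).2.1 1 le_rfl, (hHfg x hx).2.2 hxA]

namespace DiffSpace

/-- The smooth approximation property of a diffeological space `X`: a continuous map to `X` from an
open subset `M` of `ℝⁿ`, which is a plot near a subset `A` closed in `M`, is homotopic relative to
`A` to a map which is a plot on all of `M`. -/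
def SmoothApprox (X : DiffSpace.{u}) : Prop :=
  ∀ ⦃n : ℕ⦄ ⦃M N A : Set (Coord n)⦄ ⦃f : Coord n → X⦄, IsOpen M → IsOpen N → N ⊆ M → A ⊆ N →
    IsOpen (M \ A) → ContinuousOn f M → (∀ x ∈ N, PlotAt f x) →
    ∃ g : Coord n → X, (∀ x ∈ M, PlotAt g x) ∧ HomotopicOn M A f g

lemma smoothApprox_of_isEmpty (X : DiffSpace.{u}) [IsEmpty X] : SmoothApprox X :=
  fun _ _ _ _ f ↦ isEmptyElim (f 0)

variable {m : ℕ} {X : DiffSpace.{u}} {ι : Type u} {h : ι → (bdry.{u} m ⟶ X)}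

lemma rad_le_one (y : attach h) : rad h y ≤ 1 := by
  obtain ⟨x, rfl⟩ | ⟨α, d, hd, rfl⟩ := attach_cases y
  · simp
  · simpa using disk.norm_val_le d

lemma shift_of_rad_eq_one {y : attach h} (hy : rad h y = 1) (w : Coord m) : shift h y w = y := by
  obtain ⟨x, rfl⟩ | ⟨α, d, hd, rfl⟩ := attach_cases y
  · exact shift_incl x w
  · rw [rad_cell] at hy
    exact absurd hy hd.ne

/-- A continuous map to `attach h` may be deformed within the open cells to a map which is a plot
at all points sent to the cells at radius less than `7 / 8`, without losing points at which it is a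
plot. The displacement is given by the vector field `w`, scaled by the cutoff function `l`. -/
lemma exists_smooth_in_cells {n : ℕ} {M N : Set (Coord n)} {f : Coord n → attach h}
    (hM : IsOpen M) (hf : ContinuousOn f M)
    (hfN : ∀ x ∈ N, PlotAt f x) {l : Coord n → ℝ} (hl01 : ∀ x, l x ∈ Icc (0 : ℝ) 1)
    (hl : ∀ x ∈ M, PlotAt l x) (hl1 : ∀ x ∈ M, x ∉ N → ∀ᶠ y in 𝓝 x, l y = 1) :
    ∃ w : Coord n → Coord m,
      ContinuousOn (fun q : Coord n × ℝ ↦ shift h (f q.1) ((q.2 * l q.1) • w q.1))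
        (M ×ˢ univ) ∧
      (∀ x ∈ M, x ∈ N ∨ rad h (f x) < 7 / 8 → PlotAt (fun y ↦ shift h (f y) (l y • w y)) x) ∧
      ∀ x ∈ M, 7 / 8 ≤ rad h (f x) → 1 / 2 < rad h (shift h (f x) (l x • w x)) := by
  have hfc {x} (hx : x ∈ M) : ContinuousAt f x := hf.continuousAt (hM.mem_nhds hx)
  have hrc {x} (hx : x ∈ M) : ContinuousAt (fun y ↦ rad h (f y)) x :=
    continuous_rad.continuousAt.comp (hfc hx)
  let O : Set (Coord n) := {x | x ∈ M ∧ rad h (f x) < 1}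
  have hO : IsOpen O := isOpen_iff_mem_nhds.2 fun x hx ↦
    inter_mem (hM.mem_nhds hx.1) ((hrc hx.1).eventually (gt_mem_nhds hx.2))
  have hvc {x} (hx : x ∈ O) : ContinuousAt (fun y ↦ vec h (f y)) x :=
    ContinuousAt.comp (g := vec h) (continuousAt_vec hx.2) (hfc hx.1)
  obtain ⟨β, hβ⟩ := exists_plotAt_approx hO (b := fun x ↦ vec h (f x))
    (fun x hx ↦ (hvc hx).continuousWithinAt) (ε := 1 / 32) (by norm_num)
  -- `ν v` is `1` for `‖v‖ ≤ 7 / 8` and `0` for `15 / 16 ≤ ‖v‖`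
  let ν : Coord m → ℝ := fun v ↦ Real.smoothTransition (16 * (225 / 256 - ‖v‖ ^ 2))
  have hνc : ContDiff ℝ ∞ ν :=
    Real.smoothTransition.contDiff.comp
      (contDiff_const.mul (contDiff_const.sub (contDiff_norm_sq ℝ)))
  have hν0 {v : Coord m} (hv : 15 / 16 ≤ ‖v‖) : ν v = 0 :=
    Real.smoothTransition.zero_of_nonpos (by nlinarith)
  have hν1 {v : Coord m} (hv : ‖v‖ ≤ 7 / 8) : ν v = 1 :=
    Real.smoothTransition.one_of_one_le (by nlinarith [norm_nonneg v])
  let w : Coord n → Coord m := fun x ↦ ν (vec h (f x)) • (β x - vec h (f x))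
  have hwsmall {x} (hx : x ∈ O) {c : ℝ} (hc : c ∈ Icc (0 : ℝ) 1) : ‖c • w x‖ < 1 / 32 := by
    have h1 : ‖w x‖ < 1 / 32 := by
      have h2 : ‖ν (vec h (f x))‖ ≤ 1 := by
        rw [Real.norm_of_nonneg (Real.smoothTransition.nonneg _)]
        exact Real.smoothTransition.le_one _
      rw [norm_smul]
      nlinarith [(hβ x hx).2, norm_nonneg (β x - vec h (f x)), norm_nonneg (ν (vec h (f x)))]
    rw [norm_smul, Real.norm_of_nonneg hc.1]
    nlinarith [hc.1, hc.2, norm_nonneg (w x)]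
  have hfar {x} (hx : x ∈ M) (hr : 15 / 16 ≤ rad h (f x)) (c : ℝ) :
      shift h (f x) (c • w x) = f x := by
    obtain h1 | h1 := (rad_le_one (f x)).lt_or_eq
    · simp [w, hν0 (hr.trans_eq (norm_vec h1).symm)]
    · exact shift_of_rad_eq_one h1 _
  have hnear {x} (hx : x ∈ O) : rad h (shift h (f x) (l x • w x)) < 1 ∧
      vec h (shift h (f x) (l x • w x)) = vec h (f x) + l x • w x := by
    refine vec_shift hx.2 ?_
    obtain h1 | h1 := lt_or_ge (rad h (f x)) (15 / 16)
    · have h2 := hwsmall hx (hl01 x)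
      have h3 := norm_add_le (vec h (f x)) (l x • w x)
      rw [norm_vec hx.2] at h3
      linarith
    · have h2 : w x = 0 := by simp [w, hν0 (h1.trans_eq (norm_vec hx.2).symm)]
      rw [h2, smul_zero, add_zero, norm_vec hx.2]
      exact hx.2
  have hwc {x} (hx : x ∈ O) : ContinuousAt w x :=
    (hνc.continuous.continuousAt.comp (hvc hx)).smul
      ((hβ x hx).1.continuousAt_normed.sub (hvc hx))
  have hcont {x} (hx : x ∈ M) (t : ℝ) : ContinuousAt
      (fun q : Coord n × ℝ ↦ shift h (f q.1) ((q.2 * l q.1) • w q.1)) (x, t) := by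
    obtain h1 | h1 := (rad_le_one (f x)).lt_or_eq
    · have hxO : x ∈ O := ⟨hx, h1⟩
      have h2 : ContinuousAt (fun q : Coord n × ℝ ↦ (f q.1, (q.2 * l q.1) • w q.1)) (x, t) := by
        refine ContinuousAt.prodMk (ContinuousAt.comp (g := f) (hfc hx) continuousAt_fst) ?_
        refine ContinuousAt.smul (continuousAt_snd.mul ?_) ?_
        · exact ContinuousAt.comp (g := l) (hl x hx).continuousAt_normed continuousAt_fst
        · exact ContinuousAt.comp (g := w) (hwc hxO) continuousAt_fst
      exact ContinuousAt.comp (x := (x, t))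
        (f := fun q : Coord n × ℝ ↦ (f q.1, (q.2 * l q.1) • w q.1))
        (g := fun q : attach h × Coord m ↦ shift h q.1 q.2)
        (continuousAt_shift h1 ((t * l x) • w x)) h2
    · have h2 : ContinuousAt (fun q : Coord n × ℝ ↦ f q.1) (x, t) :=
        ContinuousAt.comp (g := f) (hfc hx) continuousAt_fst
      refine h2.congr ?_
      have h3 : ∀ᶠ y in 𝓝 x, y ∈ M ∧ 15 / 16 < rad h (f y) :=
        (hM.eventually_mem hx).and
          ((hrc hx).eventually (lt_mem_nhds (by dsimp only; rw [h1]; norm_num)))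
      filter_upwards [continuousAt_fst.eventually h3] with q hq
      exact (hfar hq.1 hq.2.le _).symm
  refine ⟨w, fun q hq ↦ (hcont hq.1 q.2).continuousWithinAt, fun x hx hxN ↦ ?_, fun x hx hr ↦ ?_⟩
  · obtain h1 | h1 := (rad_le_one (f x)).lt_or_eq
    · have hxO : x ∈ O := ⟨hx, h1⟩
      refine plotAt_of_vec ?_ (hnear hxO).1 ?_
      · have h2 : ContinuousAt (fun y : Coord n ↦ (y, (1 : ℝ))) x := by fun_prop
        simpa only [one_mul, Function.comp_def] using
          ContinuousAt.comp (f := fun y : Coord n ↦ (y, (1 : ℝ))) (hcont hx 1) h2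
      by_cases hN : x ∈ N
      · have h2 : PlotAt (fun y ↦ vec h (f y)) x := plotAt_vec (hfN x hN) h1
        have h3 : PlotAt w x := by
          refine PlotAt.contDiff_comp₂ (φ := fun q : Coord m × Coord m ↦ ν q.1 • (q.2 - q.1)) ?_
            h2 (hβ x hxO).1
          have := hνc.comp (contDiff_fst (E := Coord m) (F := Coord m))
          exact this.smul (contDiff_snd.sub contDiff_fst)
        have h4 : PlotAt (fun y ↦ l y • w y) x :=
          PlotAt.contDiff_comp₂ (φ := fun q : ℝ × Coord m ↦ q.1 • q.2) (by fun_prop) (hl x hx) h3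
        have h5 := PlotAt.contDiff_comp₂ (φ := fun q : Coord m × Coord m ↦ q.1 + q.2)
          (by fun_prop) h2 h4
        refine h5.congr ?_
        filter_upwards [hO.mem_nhds hxO] with y hy using (hnear hy).2
      · have hr := hxN.resolve_left hN
        refine (hβ x hxO).1.congr ?_
        filter_upwards [hO.mem_nhds hxO, hl1 x hx hN, (hrc hx).eventually (gt_mem_nhds hr)]
          with y h2 h3 h4
        rw [(hnear h2).2, h3]
        simp [w, hν1 (v := vec h (f y)) (by rw [norm_vec h2.2]; exact h4.le)]
    · have hN : x ∈ N := hxN.resolve_right (by rw [h1]; norm_num)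
      refine (hfN x hN).congr ?_
      filter_upwards [hM.mem_nhds hx, (hrc hx).eventually (lt_mem_nhds (a := 15 / 16)
        (by dsimp only; rw [h1]; norm_num))] with y h2 h3
      exact hfar h2 h3.le _
  · obtain h1 | h1 := (rad_le_one (f x)).lt_or_eq
    · have hxO : x ∈ O := ⟨hx, h1⟩
      have h2 := hwsmall hxO (hl01 x)
      rw [← norm_vec (hnear hxO).1, (hnear hxO).2]
      have h3 := norm_sub_norm_le (vec h (f x)) (-(l x • w x))
      rw [sub_neg_eq_add, norm_neg, norm_vec h1] at h3
      linarith
    · rw [shift_of_rad_eq_one h1, h1]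
      norm_num

/-- Attaching cells preserves the smooth approximation property. After smoothing inside the cells,
the radial push sends a collar of `X` to `X`, and the approximation property of `X` applies over
the collar, relative to the part lying over the inner part of the cells. -/
lemma SmoothApprox.attach (hX : SmoothApprox X) : SmoothApprox (attach h) := by
  intro n M N A f hM hN hNM hAN hMA hf hfN
  obtain ⟨l, hl01, hl, hl0, hl1⟩ := exists_smooth_cutoff hN hAN hMA
  obtain ⟨w, hwc, hwp, hwr⟩ := exists_smooth_in_cells hM hf hfN hl01 hl hl1
  have hrc {x} (hx : x ∈ M) : ContinuousAt (fun y ↦ rad h (f y)) x :=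
    continuous_rad.continuousAt.comp (hf.continuousAt (hM.mem_nhds hx))
  let f' : Coord n → DiffSpace.attach h := fun x ↦ shift h (f x) (l x • w x)
  let g : Coord n → DiffSpace.attach h := fun x ↦ push h (l x) (f' x)
  have hf'c : ContinuousOn f' M := by
    simpa only [one_mul, Function.comp_def] using hwc.comp
      (f := fun y : Coord n ↦ (y, (1 : ℝ))) (s := M) (by fun_prop) fun x hx ↦ ⟨hx, trivial⟩
  have hlc : ContinuousOn l M := fun x hx ↦ (hl x hx).continuousAt_normed.continuousWithinAt
  have hgc : ContinuousOn g M := continuous_push.comp_continuousOn (hlc.prodMk hf'c)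
  have hfg : HomotopicOn M A f g := by
    let c : ℝ → ℝ := fun t ↦ projIcc (0 : ℝ) 1 zero_le_one t
    have hc : Continuous c := continuous_subtype_val.comp continuous_projIcc
    refine ⟨fun q ↦ push h (c q.2 * l q.1) (shift h (f q.1) ((c q.2 * l q.1) • w q.1)), ?_,
      fun x hx ↦ ⟨fun t ht ↦ ?_, fun t ht ↦ ?_, fun hxA t ↦ ?_⟩⟩
    · refine continuous_push.comp_continuousOn (ContinuousOn.prodMk ?_ ?_)
      · exact (hc.comp continuous_snd).continuousOn.mul
          (hlc.comp continuousOn_fst fun q hq ↦ hq.1)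
      · exact hwc.comp (f := fun q : Coord n × ℝ ↦ (q.1, c q.2))
          (by fun_prop) fun q hq ↦ ⟨hq.1, trivial⟩
    · have : c t = 0 := by simp [c, projIcc_of_le_left zero_le_one ht]
      simp [this, push_zero]
    · have : c t = 1 := by simp [c, projIcc_of_right_le zero_le_one ht]
      simp [this, g, f']
    · simp [hl0 x hxA, push_zero]
  -- the points where `g` is known to be a plot
  let N' : Set (Coord n) := {x | x ∈ M ∧ (x ∈ N ∨ rad h (f x) < 7 / 8)}
  have hN' : IsOpen N' := isOpen_iff_mem_nhds.2 fun x hx ↦ by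
    obtain h1 | h1 := hx.2
    · filter_upwards [hN.mem_nhds h1] with y hy using ⟨hNM hy, .inl hy⟩
    · filter_upwards [hM.mem_nhds hx.1, (hrc hx.1).eventually (gt_mem_nhds h1)] with y h2 h3
        using ⟨h2, .inr h3⟩
  have hgN' {x} (hx : x ∈ N') : PlotAt g x := plotAt_push (hwp x hx.1 hx.2) (hl x hx.1) hl01
  -- the points near which `g` maps to `X`
  let W : Set (Coord n) := {x | x ∈ M ∧ 1 / 2 < rad h (f' x) ∧ ∀ᶠ y in 𝓝 x, l y = 1}
  have hW : IsOpen W := isOpen_iff_mem_nhds.2 fun x hx ↦ by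
    have h1 := (continuous_rad.continuousAt.comp (hf'c.continuousAt (hM.mem_nhds hx.1))).eventually
      (lt_mem_nhds hx.2.1)
    filter_upwards [hM.mem_nhds hx.1, h1, hx.2.2.eventually_nhds] with y h2 h3 h4
      using ⟨h2, h3, h4⟩
  have hWM : W ⊆ M := fun x hx ↦ hx.1
  have hWN' {x} (hx : x ∈ M) (hxN' : x ∉ N') : x ∈ W := by
    have h1 : x ∉ N := fun h1 ↦ hxN' ⟨hx, .inl h1⟩
    have h2 : 7 / 8 ≤ rad h (f x) := not_lt.1 fun h2 ↦ hxN' ⟨hx, .inr h2⟩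
    exact ⟨hx, hwr x hx h2, hl1 x hx h1⟩
  have hgW {x} (hx : x ∈ W) : ∃ a, g x = (attachIncl h).toFun a := by
    simp only [g, hx.2.2.self_of_nhds]
    exact exists_push_one hx.2.1
  obtain hXe | hXn := isEmpty_or_nonempty X
  · refine ⟨g, fun x hx ↦ ?_, hfg⟩
    by_cases hxN' : x ∈ N'
    · exact hgN' hxN'
    · exact isEmptyElim (hgW (hWN' hx hxN')).choose
  let g₀ : Coord n → X := fun x ↦ Function.invFun (attachIncl h).toFun (g x)
  have hg₀ {x} (hx : x ∈ W) : (attachIncl h).toFun (g₀ x) = g x := by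
    obtain ⟨a, ha⟩ := hgW hx
    exact Function.invFun_eq ⟨a, ha.symm⟩
  -- `k` separates the points where `g` has to be deformed from those outside `W`
  obtain ⟨k, -, hk, hk0, hk1⟩ := exists_smooth_cutoff (M := M) (N := N') (A := M \ W) hN'
    (fun x hx ↦ by
      by_contra hxN'
      exact hx.2 (hWN' hx.1 hxN')) (by rwa [sdiff_sdiff_right_self, inter_eq_right.2 hWM])
  have hkc {x} (hx : x ∈ M) : ContinuousAt k x := (hk x hx).continuousAt_normed
  let B : Set (Coord n) := {x | x ∈ W ∧ k x ≤ 1 / 2}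
  have hg₀c : ContinuousOn g₀ W := by
    rw [isInducing_attachIncl (h := h).continuousOn_iff]
    exact (hgc.mono hWM).congr fun x hx ↦ hg₀ hx
  obtain ⟨g₁, hg₁, H, hH, hHg⟩ := hX (M := W) (N := W ∩ N') (A := B) (f := g₀) hW (hW.inter hN')
    inter_subset_left (fun x hx ↦ ⟨hx.1, by
      by_contra hxN'
      have := (hk1 x hx.1.1 hxN').self_of_nhds
      have := hx.2
      linarith⟩)
    (isOpen_iff_mem_nhds.2 fun x hx ↦ by
      have h1 : 1 / 2 < k x := not_le.1 fun h1 ↦ hx.2 ⟨hx.1, h1⟩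
      filter_upwards [hW.mem_nhds hx.1, (hkc hx.1.1).eventually (lt_mem_nhds h1)] with y h2 h3
        using ⟨h2, fun h4 ↦ not_lt.2 h4.2 h3⟩) hg₀c
    fun x hx ↦ plotAt_of_incl (h := h) ((hgN' hx.2).congr
      (by filter_upwards [hW.mem_nhds hx.1] with y hy using hg₀ hy))
  classical
  have hout {x} (hx : x ∈ M) (hxW : x ∉ W) : ∀ᶠ y in 𝓝 x, y ∈ M ∧ k y < 1 / 2 :=
    (hM.eventually_mem hx).and ((hkc hx).eventually
      (gt_mem_nhds (by rw [hk0 x ⟨hx, hxW⟩]; norm_num)))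
  refine ⟨fun x ↦ if x ∈ W then (attachIncl h).toFun (g₁ x) else g x, fun x hx ↦ ?_,
    hfg.trans ⟨fun q ↦ if q.1 ∈ W then (attachIncl h).toFun (H q) else g q.1, ?_,
      fun x hx ↦ ⟨fun t ht ↦ ?_, fun t ht ↦ ?_, fun hxA t ↦ ?_⟩⟩⟩
  · by_cases hxW : x ∈ W
    · refine ((hg₁ x hxW).dSmooth (attachIncl h).smooth).congr ?_
      filter_upwards [hW.mem_nhds hxW] with y hy using if_pos hy
    · have hxN' : x ∈ N' := by
        by_contra hxN'
        exact hxW (hWN' hx hxN')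
      refine (hgN' hxN').congr ?_
      filter_upwards [hout hx hxW] with y hy
      split_ifs with hyW
      · rw [← hg₀ hyW, ← (hHg y hyW).2.1 1 le_rfl, (hHg y hyW).2.2 ⟨hyW, hy.2.le⟩]
      · rfl
  · rintro ⟨x, t⟩ ⟨hx, -⟩
    refine ContinuousAt.continuousWithinAt ?_
    by_cases hxW : x ∈ W
    · have h1 : ContinuousAt H (x, t) :=
        hH.continuousAt ((hW.prod isOpen_univ).mem_nhds ⟨hxW, trivial⟩)
      refine ((attachIncl h).continuous.continuousAt.comp h1).congr ?_
      filter_upwards [continuousAt_fst.eventually (hW.mem_nhds hxW)] with q hq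
      exact (if_pos hq).symm
    · have h1 : ContinuousAt (fun q : Coord n × ℝ ↦ g q.1) (x, t) :=
        ContinuousAt.comp (g := g) (hgc.continuousAt (hM.mem_nhds hx)) continuousAt_fst
      refine h1.congr ?_
      filter_upwards [continuousAt_fst.eventually (hout hx hxW)] with q hq
      split_ifs with hqW
      · rw [← hg₀ hqW, (hHg q.1 hqW).2.2 ⟨hqW, hq.2.le⟩]
      · rfl
  · dsimp only
    split_ifs with hxW
    · rw [(hHg x hxW).1 t ht, hg₀ hxW]
    · rfl
  · dsimp only
    split_ifs with hxW
    · rw [(hHg x hxW).2.1 t ht]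
    · rfl
  · have hxW : x ∉ W := fun hxW ↦ by
      have := hxW.2.2.self_of_nhds
      rw [hl0 x hxA] at this
      exact zero_ne_one this
    exact if_neg hxW

end DiffSpace

/-! ### Extending maps over cylinders -/

/-- Continuous maps on two closed sets which cover a space glue if they agree on the overlap. -/
lemma exists_glue_isClosed {Q T : Type*} [TopologicalSpace Q] [TopologicalSpace T] {S S' : Set Q}
    (hS : IsClosed S) (hS' : IsClosed S') (hSS' : ∀ q, q ∈ S ∨ q ∈ S') (a : C(S, T)) (b : C(S', T))
    (hab : ∀ q (h : q ∈ S) (h' : q ∈ S'), a ⟨q, h⟩ = b ⟨q, h'⟩) :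
    ∃ W : C(Q, T), (∀ q (h : q ∈ S), W q = a ⟨q, h⟩) ∧ ∀ q (h : q ∈ S'), W q = b ⟨q, h⟩ := by
  classical
  let W : Q → T := fun q ↦ if h : q ∈ S then a ⟨q, h⟩ else b ⟨q, (hSS' q).resolve_left h⟩
  have h1 (q) (h : q ∈ S) : W q = a ⟨q, h⟩ := dif_pos h
  have h2 (q) (h : q ∈ S') : W q = b ⟨q, h⟩ := by
    by_cases hq : q ∈ S
    · rw [h1 q hq, hab q hq h]
    · exact dif_neg hq
  refine ⟨⟨W, ?_⟩, h1, h2⟩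
  rw [← continuousOn_univ, ← eq_univ_of_forall (s := S ∪ S') hSS']
  refine ContinuousOn.union_of_isClosed ?_ ?_ hS hS'
  · refine continuousOn_iff_continuous_domRestrict.2 (a.continuous.congr fun q ↦ (h1 q q.2).symm)
  · refine continuousOn_iff_continuous_domRestrict.2 (b.continuous.congr fun q ↦ (h2 q q.2).symm)

/-- The unit sphere of a normed space. -/
abbrev USphere (V : Type*) [SeminormedAddCommGroup V] : Type _ := Metric.sphere (0 : V) 1

/-- The closed unit ball of a normed space. -/
abbrev UBall (V : Type*) [SeminormedAddCommGroup V] : Type _ := Metric.closedBall (0 : V) 1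

/-- The inclusion of the unit sphere in the closed unit ball. -/
def usphereIncl (V : Type*) [SeminormedAddCommGroup V] : C(USphere V, UBall V) :=
  ⟨inclusion Metric.sphere_subset_closedBall, continuous_inclusion _⟩

lemma UBall.norm_le {V : Type*} [SeminormedAddCommGroup V] (x : UBall V) :
    ‖x.1‖ ≤ 1 := mem_closedBall_zero_iff.1 x.2

lemma USphere.norm_eq {V : Type*} [SeminormedAddCommGroup V] (x : USphere V) :
    ‖x.1‖ = 1 := mem_sphere_zero_iff_norm.1 x.2

@[simp] lemma coe_usphereIncl {V : Type*} [SeminormedAddCommGroup V] (x : USphere V) :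
    (usphereIncl V x).1 = x.1 := rfl

section extension

variable {V : Type*} [NormedAddCommGroup V] [NormedSpace ℝ V] {T : Type*} [TopologicalSpace T]

/-- A map defined on the sides and the bottom of the cylinder over the unit ball of a normed space
extends to the whole cylinder: compose with the projection of the cylinder `‖x‖ ≤ 1`,
`0 ≤ t ≤ 1` from the point `(0, 2)`. -/
lemma exists_cylinder_extension (u : C(USphere V × I, T)) (v : C(UBall V, T))
    (huv : ∀ x, u (x, 0) = v (usphereIncl V x)) :
    ∃ W : C(UBall V × I, T), (∀ x, W (x, 0) = v x) ∧ ∀ x t, W (usphereIncl V x, t) = u (x, t) := by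
  let S : Set (UBall V × I) := {q | 1 - (q.2 : ℝ) / 2 ≤ ‖q.1.1‖}
  let S' : Set (UBall V × I) := {q | ‖q.1.1‖ ≤ 1 - (q.2 : ℝ) / 2}
  have hpos (q) (hq : q ∈ S) : 0 < ‖q.1.1‖ := by
    have : 1 - (q.2 : ℝ) / 2 ≤ ‖q.1.1‖ := hq
    linarith [q.2.2.2]
  have hpos' (q : UBall V × I) : 0 < 1 - (q.2 : ℝ) / 2 := by linarith [q.2.2.2]
  -- the projection to the sides, and the projection to the bottom
  let a : S → USphere V × I := fun q ↦
    (⟨‖q.1.1.1‖⁻¹ • q.1.1.1, by simp [norm_smul, (hpos _ q.2).ne']⟩,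
      projIcc 0 1 zero_le_one (2 - (2 - (q.1.2 : ℝ)) * ‖q.1.1.1‖⁻¹))
  have ha : Continuous a := by
    have h1 : Continuous fun q : S ↦ ‖q.1.1.1‖⁻¹ :=
      Continuous.inv₀ (by fun_prop) fun q ↦ (hpos _ q.2).ne'
    refine Continuous.prodMk (Continuous.subtype_mk (h1.smul (by fun_prop)) _)
      (continuous_projIcc.comp ?_)
    fun_prop
  let b : S' → UBall V := fun q ↦ ⟨(1 - (q.1.2 : ℝ) / 2)⁻¹ • q.1.1.1, by
    have h1 : ‖q.1.1.1‖ ≤ 1 - (q.1.2 : ℝ) / 2 := q.2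
    rwa [mem_closedBall_zero_iff, norm_smul, norm_inv, Real.norm_of_nonneg (hpos' q.1).le,
      inv_mul_le_iff₀ (hpos' q.1), mul_one]⟩
  have hb : Continuous b := by
    have h1 : Continuous fun q : S' ↦ (1 - (q.1.2 : ℝ) / 2)⁻¹ :=
      Continuous.inv₀ (by fun_prop) fun q ↦ (hpos' q.1).ne'
    exact Continuous.subtype_mk (h1.smul (by fun_prop)) _
  obtain ⟨W, hW, hW'⟩ := exists_glue_isClosed (S := S) (S' := S')
    (isClosed_le (by fun_prop) (by fun_prop)) (isClosed_le (by fun_prop) (by fun_prop))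
    (fun q ↦ le_total (1 - (q.2 : ℝ) / 2) ‖q.1.1‖) (u.comp ⟨a, ha⟩) (v.comp ⟨b, hb⟩)
    (fun q hq hq' ↦ by
      have h1 : 1 - (q.2 : ℝ) / 2 = ‖q.1.1‖ := le_antisymm hq hq'
      have h2 : a ⟨q, hq⟩ = ((a ⟨q, hq⟩).1, 0) := by
        refine Prod.ext rfl (projIcc_of_le_left zero_le_one ?_)
        have h3 : 2 - (q.2 : ℝ) = 2 * ‖q.1.1‖ := by linarith
        simp [h3, (hpos q hq).ne']
      change u (a ⟨q, hq⟩) = v (b ⟨q, hq'⟩)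
      rw [h2, huv]
      congr 1
      refine Subtype.ext ?_
      simp only [coe_usphereIncl, a, b, h1])
  refine ⟨W, fun x ↦ ?_, fun x t ↦ ?_⟩
  · have h1 : ‖x.1‖ ≤ 1 - ((0 : I) : ℝ) / 2 := by simpa using x.norm_le
    rw [hW' _ h1]
    refine congrArg v (Subtype.ext ?_)
    simp [b]
  · have h1 : 1 - (t : ℝ) / 2 ≤ ‖(usphereIncl V x).1‖ := by
      rw [coe_usphereIncl, x.norm_eq]
      linarith [t.2.1]
    rw [hW _ h1]
    refine congrArg u (Prod.ext (Subtype.ext ?_) ?_)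
    · simp [a]
    · have : 2 - (2 - (t : ℝ)) = t := by ring
      simp [a, this]

end extension

/-- `p` has the right lifting property with respect to the inclusions of the sides and the bottom
in cylinders over disks. -/
def CylLift {E B : Type*} [TopologicalSpace E] [TopologicalSpace B] (p : C(E, B)) : Prop :=
  ∀ (m : ℕ) (u : C(USphere (Coord m) × I, E)) (v : C(UBall (Coord m), E))
    (w : C(UBall (Coord m) × I, B)), (∀ x, u (x, 0) = v (usphereIncl _ x)) →
    (∀ x t, p (u (x, t)) = w (usphereIncl _ x, t)) → (∀ x, p (v x) = w (x, 0)) →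
    ∃ W : C(UBall (Coord m) × I, E), (∀ x t, W (usphereIncl _ x, t) = u (x, t)) ∧
      (∀ x, W (x, 0) = v x) ∧ ∀ q, p (W q) = w q

lemma CylLift.of_subsingleton {E B : Type*} [TopologicalSpace E] [TopologicalSpace B]
    [Subsingleton B] (p : C(E, B)) : CylLift p := fun m u v w huv _ _ ↦ by
  obtain ⟨W, h1, h2⟩ := exists_cylinder_extension u v huv
  exact ⟨W, h2, h1, fun q ↦ Subsingleton.elim _ _⟩

/-- The map which sends a path to its pair of end points. -/
def pathEnds (B : Type*) [TopologicalSpace B] : C(C(I, B), B × B) :=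
  ⟨fun γ ↦ (γ 0, γ 1), by fun_prop⟩

/-- The path fibration has the lifting property: a lifting problem for the cylinder over a disk is
an extension problem for the cylinder over the product of the disk with the interval of paths,
which is the unit ball of `ℝᵐ × ℝ` with the sup norm. -/
lemma CylLift.pathEnds (B : Type*) [TopologicalSpace B] : CylLift (pathEnds B) := by
  intro m u v w huv huw hvw
  have hn1 (x : UBall (Coord m × ℝ)) : ‖x.1.1‖ ≤ 1 := (norm_fst_le x.1).trans x.norm_le
  have hn2 (x : UBall (Coord m × ℝ)) : |x.1.2| ≤ 1 := (norm_snd_le x.1).trans x.norm_le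
  let τ : ℝ → I := fun s ↦ projIcc 0 1 zero_le_one ((1 + s) / 2)
  have hτ : Continuous τ := continuous_projIcc.comp (by fun_prop)
  have hτ0 : τ (-1) = 0 := projIcc_of_le_left _ (by norm_num)
  have hτ1 : τ 1 = 1 := projIcc_of_right_le _ (by norm_num)
  have hτI (s : I) : τ (2 * s - 1) = s := by
    have : (1 + (2 * (s : ℝ) - 1)) / 2 = s := by ring
    simp only [τ, this, projIcc_val]
  let π : C(UBall (Coord m × ℝ), UBall (Coord m)) :=
    ⟨fun x ↦ ⟨x.1.1, by simpa using hn1 x⟩, by fun_prop⟩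
  let v' : C(UBall (Coord m × ℝ), B) := ⟨fun x ↦ v (π x) (τ x.1.2), by fun_prop⟩
  -- the given map on the ends of the interval of paths
  let C1 : Set (USphere (Coord m × ℝ) × I) := {q | 1 ≤ |q.1.1.2|}
  have hC1 (q) (hq : q ∈ C1) : |q.1.1.2| = 1 := le_antisymm (hn2 (usphereIncl (Coord m × ℝ) q.1)) hq
  let S : Set C1 := {q | q.1.1.1.2 ≤ 0}
  let S' : Set C1 := {q | 0 ≤ q.1.1.1.2}
  obtain ⟨U₁, hU0, hU1⟩ := exists_glue_isClosed (S := S) (S' := S')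
    (isClosed_le (by fun_prop) (by fun_prop)) (isClosed_le (by fun_prop) (by fun_prop))
    (fun q ↦ le_total q.1.1.1.2 0)
    ⟨fun q ↦ (w (π (usphereIncl (Coord m × ℝ) q.1.1.1), q.1.1.2)).1, by fun_prop⟩
    ⟨fun q ↦ (w (π (usphereIncl (Coord m × ℝ) q.1.1.1), q.1.1.2)).2, by fun_prop⟩
    (fun q h0 h1 ↦ by
      have h2 := hC1 _ q.2
      have h3 : q.1.1.1.2 = 0 := le_antisymm h0 h1
      simp [h3] at h2)
  replace hU0 (q : C1) (hq : q.1.1.1.2 = -1) :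
      U₁ q = (w (π (usphereIncl (Coord m × ℝ) q.1.1), q.1.2)).1 :=
    hU0 q (show q.1.1.1.2 ≤ 0 by rw [hq]; norm_num)
  replace hU1 (q : C1) (hq : q.1.1.1.2 = 1) :
      U₁ q = (w (π (usphereIncl (Coord m × ℝ) q.1.1), q.1.2)).2 :=
    hU1 q (show 0 ≤ q.1.1.1.2 by rw [hq]; norm_num)
  -- the given map on the boundary of the disk
  let C2 : Set (USphere (Coord m × ℝ) × I) := {q | 1 ≤ ‖q.1.1.1‖}
  have hC2 (q) (hq : q ∈ C2) : ‖q.1.1.1‖ = 1 := le_antisymm (hn1 (usphereIncl (Coord m × ℝ) q.1)) hq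
  let ρ : C(C2, USphere (Coord m)) := ⟨fun q ↦ ⟨q.1.1.1.1, by simpa using hC2 q.1 q.2⟩, by fun_prop⟩
  have hρ (q : C2) : usphereIncl _ (ρ q) = π (usphereIncl (Coord m × ℝ) q.1.1) := rfl
  obtain ⟨U, hU₁, hU₂⟩ := exists_glue_isClosed (S := C1) (S' := C2)
    (isClosed_le (by fun_prop) (by fun_prop)) (isClosed_le (by fun_prop) (by fun_prop))
    (fun q ↦ by
      by_contra! h
      have h1 : ‖q.1.1.2‖ < 1 := not_le.1 h.1
      have h2 : ‖q.1.1.1‖ < 1 := not_le.1 h.2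
      have h3 : max ‖q.1.1.1‖ ‖q.1.1.2‖ = 1 := q.1.norm_eq
      exact absurd h3 (max_lt h2 h1).ne) U₁
    ⟨fun q ↦ u (ρ q, q.1.2) (τ q.1.1.1.2), by fun_prop⟩ (fun q h h' ↦ by
      have h2 := huw (ρ ⟨q, h'⟩) q.2
      rw [hρ] at h2
      obtain h1 | h1 := (abs_eq zero_le_one).1 (hC1 q h)
      · rw [hU1 ⟨q, h⟩ h1, ← h2]
        change _ = u (_, q.2) (τ q.1.1.2)
        rw [h1, hτ1]
        rfl
      · rw [hU0 ⟨q, h⟩ h1, ← h2]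
        change _ = u (_, q.2) (τ q.1.1.2)
        rw [h1, hτ0]
        rfl)
  have hUu (q) (hq : q ∈ C2) : U q = u (ρ ⟨q, hq⟩, q.2) (τ q.1.1.2) := hU₂ q hq
  have hUw0 (q : USphere (Coord m × ℝ) × I) (hq : q.1.1.2 = -1) :
      U q = (w (π (usphereIncl (Coord m × ℝ) q.1), q.2)).1 := by
    have h1 : q ∈ C1 := by simp [C1, hq]
    rw [hU₁ q h1, hU0 ⟨q, h1⟩ hq]
  have hUw1 (q : USphere (Coord m × ℝ) × I) (hq : q.1.1.2 = 1) :
      U q = (w (π (usphereIncl (Coord m × ℝ) q.1), q.2)).2 := by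
    have h1 : q ∈ C1 := by simp [C1, hq]
    rw [hU₁ q h1, hU1 ⟨q, h1⟩ hq]
  obtain ⟨W, hWv, hWU⟩ := exists_cylinder_extension U v' (fun x ↦ by
    have h2 := hvw (π (usphereIncl (Coord m × ℝ) x))
    by_cases h : (x, (0 : I)) ∈ C2
    · rw [hUu _ h, huv, hρ]
      rfl
    · have h1 : |x.1.2| = 1 := by
        have h3 : max ‖x.1.1‖ ‖x.1.2‖ = 1 := x.norm_eq
        have h4 : ‖x.1.1‖ < 1 := not_le.1 h
        obtain h5 | h5 := max_choice ‖x.1.1‖ ‖x.1.2‖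
        · rw [h3] at h5
          exact absurd h5 h4.ne'
        · rw [h3] at h5
          exact h5.symm
      obtain h1 | h1 := (abs_eq zero_le_one).1 h1
      · rw [hUw1 (x, 0) h1, ← h2]
        change _ = v _ (τ x.1.2)
        rw [h1, hτ1]
        rfl
      · rw [hUw0 (x, 0) h1, ← h2]
        change _ = v _ (τ x.1.2)
        rw [h1, hτ0]
        rfl)
  have hκ (x : UBall (Coord m)) (s : I) : ‖((x.1, 2 * (s : ℝ) - 1) : Coord m × ℝ)‖ ≤ 1 := by
    refine max_le x.norm_le ?_
    rw [Real.norm_eq_abs, abs_le]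
    constructor <;> linarith [s.2.1, s.2.2]
  let κ : C((UBall (Coord m) × I) × I, UBall (Coord m × ℝ) × I) :=
    ⟨fun q ↦ (⟨(q.1.1.1, 2 * (q.2 : ℝ) - 1), mem_closedBall_zero_iff.2 (hκ q.1.1 q.2)⟩, q.1.2),
      by fun_prop⟩
  have hκs (x : UBall (Coord m)) (s t : I) (h : ‖((x.1, 2 * (s : ℝ) - 1) : Coord m × ℝ)‖ = 1) :
      W (κ ((x, t), s)) = U (⟨(x.1, 2 * (s : ℝ) - 1), mem_sphere_zero_iff_norm.2 h⟩, t) := by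
    rw [← hWU]
    rfl
  refine ⟨(W.comp κ).curry, fun x t ↦ ContinuousMap.ext fun s ↦ ?_,
    fun x ↦ ContinuousMap.ext fun s ↦ ?_, fun q ↦ Prod.ext ?_ ?_⟩
  · have h1 : ‖(((usphereIncl _ x).1, 2 * (s : ℝ) - 1) : Coord m × ℝ)‖ = 1 := by
      refine le_antisymm (hκ _ s) ?_
      exact le_max_of_le_left x.norm_eq.ge
    change W (κ ((usphereIncl _ x, t), s)) = _
    have h2 : ((⟨((usphereIncl _ x).1, 2 * (s : ℝ) - 1), mem_sphere_zero_iff_norm.2 h1⟩, t) :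
        USphere (Coord m × ℝ) × I) ∈
      C2 := x.norm_eq.ge
    rw [hκs _ _ _ h1, hUu _ h2, hτI]
    rfl
  · change W (κ ((x, 0), s)) = v x s
    have h1 : κ ((x, 0), s) = ((κ ((x, 0), s)).1, 0) := rfl
    rw [h1, hWv]
    change v x (τ (2 * s - 1)) = _
    rw [hτI]
  · change W (κ ((q.1, q.2), 0)) = _
    have h1 : ‖((q.1.1, 2 * ((0 : I) : ℝ) - 1) : Coord m × ℝ)‖ = 1 := by
      refine le_antisymm (hκ _ 0) (le_max_of_le_right ?_)
      simp
    rw [hκs _ _ _ h1, hUw0 _ (by simp)]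
    rfl
  · change W (κ ((q.1, q.2), 1)) = _
    have h1 : ‖((q.1.1, 2 * ((1 : I) : ℝ) - 1) : Coord m × ℝ)‖ = 1 := by
      refine le_antisymm (hκ _ 1) (le_max_of_le_right ?_)
      norm_num
    rw [hκs _ _ _ h1, hUw1 _ (by norm_num)]
    rfl

/-! ### Attaching cylinders over disks along their sides -/

/-- Disjoint unions of the inclusions of the sides in the cylinders over the `m`-disk. -/
def cylSidesIncl (ι : Type u) (m : ℕ) :
    TopCat.of ((_ : ι) × (USphere (Coord m) × I)) ⟶ TopCat.of ((_ : ι) × (UBall (Coord m) × I)) :=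
  TopCat.ofHom (ContinuousMap.sigma fun α ↦ (ContinuousMap.sigmaMk α).comp
    ((usphereIncl (Coord m)).prodMap (ContinuousMap.id I)))

section attachCyl

variable {Z : TopCat.{u}} {ι : Type u} {m : ℕ} (K : ι → C(USphere (Coord m) × I, Z))

/-- The space obtained from `Z` by attaching cylinders over `m`-disks along their sides. -/
def attachCyl : TopCat.{u} :=
  pushout (TopCat.ofHom (ContinuousMap.sigma K)) (cylSidesIncl ι m)

/-- The map from `Z` to the space obtained by attaching cylinders. -/
def attachCylIncl : Z ⟶ attachCyl K :=
  pushout.inl (TopCat.ofHom (ContinuousMap.sigma K)) (cylSidesIncl ι m)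

/-- The characteristic map of a cylinder. -/
def attachCylCell (α : ι) : C(UBall (Coord m) × I, attachCyl K) :=
  (pushout.inr (TopCat.ofHom (ContinuousMap.sigma K)) (cylSidesIncl ι m)).hom.comp
    (ContinuousMap.sigmaMk (X := fun _ : ι ↦ UBall (Coord m) × I) α)

variable {K}

lemma attachCyl_glue (α : ι) (x : USphere (Coord m)) (t : I) :
    attachCylCell K α (usphereIncl _ x, t) = attachCylIncl K (K α (x, t)) :=
  (ConcreteCategory.congr_hom (pushout.condition (f := TopCat.ofHom (ContinuousMap.sigma K))
    (g := cylSidesIncl ι m)) (⟨α, x, t⟩ : (_ : ι) × (USphere (Coord m) × I))).symm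

lemma attachCyl_exists_desc {T : TopCat.{u}} (f : Z ⟶ T) (g : ι → C(UBall (Coord m) × I, T))
    (hfg : ∀ α x t, g α (usphereIncl _ x, t) = f (K α (x, t))) :
    ∃ l : attachCyl K ⟶ T, attachCylIncl K ≫ l = f ∧ ∀ α q, l (attachCylCell K α q) = g α q := by
  have h : TopCat.ofHom (ContinuousMap.sigma K) ≫ f =
      cylSidesIncl ι m ≫ TopCat.ofHom (ContinuousMap.sigma g) := by
    ext ⟨α, x, t⟩
    exact (hfg α x t).symm
  refine ⟨pushout.desc f (TopCat.ofHom (ContinuousMap.sigma g)) h, pushout.inl_desc _ _ _,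
    fun α q ↦ ?_⟩
  exact ConcreteCategory.congr_hom (pushout.inr_desc _ _ h)
    (⟨α, q⟩ : (_ : ι) × (UBall (Coord m) × I))

lemma attachCyl_hom_ext {T : TopCat.{u}} {f g : attachCyl K ⟶ T}
    (h : attachCylIncl K ≫ f = attachCylIncl K ≫ g)
    (h' : ∀ α q, f (attachCylCell K α q) = g (attachCylCell K α q)) : f = g := by
  refine pushout.hom_ext h ?_
  ext ⟨α, q⟩
  exact h' α q

/-- Lifting over attached cylinders, starting from one of the two ends of the cylinders. -/
lemma attachCyl_exists_lift {E B : TopCat.{u}} {p : E ⟶ B} (hp : CylLift p.hom) {e : I}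
    (he : e = 0 ∨ e = 1) {l : Z ⟶ E} {w : attachCyl K ⟶ B} (hlw : l ≫ p = attachCylIncl K ≫ w)
    (v : ι → C(UBall (Coord m), E)) (hvl : ∀ α x, v α (usphereIncl _ x) = l (K α (x, e)))
    (hvw : ∀ α x, p (v α x) = w (attachCylCell K α (x, e))) :
    ∃ l' : attachCyl K ⟶ E, attachCylIncl K ≫ l' = l ∧ l' ≫ p = w ∧
      ∀ α x, l' (attachCylCell K α (x, e)) = v α x := by
  -- a time reversal which sends `0` to `e`
  obtain ⟨τ, hττ, hτ⟩ : ∃ τ : C(I, I), (∀ t, τ (τ t) = t) ∧ τ 0 = e := by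
    obtain rfl | rfl := he
    · exact ⟨.id I, fun _ ↦ rfl, rfl⟩
    · exact ⟨⟨unitInterval.symm, by fun_prop⟩, unitInterval.symm_symm, unitInterval.symm_zero⟩
  have hlw' (z : Z) : p (l z) = w (attachCylIncl K z) := ConcreteCategory.congr_hom hlw z
  have (α : ι) := hp m ((l.hom.comp (K α)).comp ((ContinuousMap.id _).prodMap τ)) (v α)
    ((w.hom.comp (attachCylCell K α)).comp ((ContinuousMap.id _).prodMap τ))
    (fun x ↦ by
      change l (K α (x, τ 0)) = _
      rw [hvl, hτ])
    (fun x t ↦ by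
      change p (l (K α (x, τ t))) = w (attachCylCell K α (usphereIncl _ x, τ t))
      rw [hlw', attachCyl_glue])
    (fun x ↦ by
      change _ = w (attachCylCell K α (x, τ 0))
      rw [hτ]
      exact hvw α x)
  choose W hWu hWv hWw using this
  obtain ⟨l', hl', hl'c⟩ := attachCyl_exists_desc l
    (fun α ↦ (W α).comp ((ContinuousMap.id _).prodMap τ)) (fun α x t ↦ by
      change W α (usphereIncl _ x, τ t) = _
      rw [hWu]
      change l (K α (x, τ (τ t))) = _
      rw [hττ])
  have hτe : τ e = 0 := by rw [← hτ, hττ]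
  refine ⟨l', hl', attachCyl_hom_ext ?_ fun α q ↦ ?_, fun α x ↦ ?_⟩
  · rw [← Category.assoc, hl', hlw]
  · change p (l' _) = _
    rw [hl'c]
    refine (hWw α _).trans ?_
    change w (attachCylCell K α (q.1, τ (τ q.2))) = _
    rw [hττ]
  · rw [hl'c]
    change W α (x, τ e) = _
    rw [hτe, hWv]

end attachCyl

/-! ### Deformation retracts from lifting properties -/

/-- `i` has the left lifting property with respect to all maps `p` with `CylLift p`. -/
def CylAnodyne {A Z : TopCat.{u}} (i : A ⟶ Z) : Prop :=
  ∀ ⦃E B : TopCat.{u}⦄ (p : E ⟶ B), CylLift p.hom → ∀ (f : A ⟶ E) (w : Z ⟶ B), f ≫ p = i ≫ w →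
    ∃ l : Z ⟶ E, i ≫ l = f ∧ l ≫ p = w

/-- A map with the lifting property is the inclusion of a deformation retract. -/
lemma CylAnodyne.exists_retraction {A Z : TopCat.{u}} {i : A ⟶ Z} (hi : CylAnodyne i) :
    ∃ r : Z ⟶ A, i ≫ r = 𝟙 A ∧ ∃ H : C(Z × I, Z), ∀ z, H (z, 0) = z ∧ H (z, 1) = i (r z) := by
  obtain ⟨r, hr, -⟩ := hi (B := TopCat.of PUnit.{u + 1}) (TopCat.ofHom (.const A PUnit.unit))
    (CylLift.of_subsingleton _) (𝟙 A) (TopCat.ofHom (.const Z PUnit.unit)) rfl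
  refine ⟨r, hr, ?_⟩
  have hr' (a : A) : r (i a) = a := ConcreteCategory.congr_hom hr a
  obtain ⟨l, -, hl⟩ := hi (TopCat.ofHom (pathEnds Z)) (CylLift.pathEnds Z)
    (TopCat.ofHom (ContinuousMap.curry (i.hom.comp ContinuousMap.fst)))
    (TopCat.ofHom ((ContinuousMap.id Z).prodMk (i.hom.comp r.hom))) (by
      ext a
      · rfl
      · change i a = i (r (i a))
        rw [hr'])
  have hl' (z : Z) : ((l z : C(I, Z)) 0, (l z : C(I, Z)) 1) = (z, i (r z)) :=
    ConcreteCategory.congr_hom hl z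
  refine ⟨⟨fun q ↦ (l.hom q.1 : C(I, Z)) q.2, ?_⟩, fun z ↦ Prod.ext_iff.1 (hl' z)⟩
  exact ContinuousEval.continuous_eval.comp ((l.hom.continuous.comp continuous_fst).prodMk
    continuous_snd)

/-! ### Smoothing the attaching maps -/

/-- A continuous map from a sphere to `X` is homotopic to a smooth one: extend it radially to the
complement of the origin, and approximate it there. -/
lemma DiffSpace.SmoothApprox.exists_homotopic_smooth {X : DiffSpace.{u}} (hX : X.SmoothApprox)
    {m : ℕ} (f : C(USphere (Coord m), X)) :
    ∃ g : C(USphere (Coord m), X), f.Homotopic g ∧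
      ∃ h : bdry.{u} m ⟶ X, ∀ x : USphere (Coord m), h.toFun (bdry.mk x.1 x.norm_eq) = g x := by
  obtain hS | ⟨⟨x₀⟩⟩ := isEmpty_or_nonempty (USphere (Coord m))
  · have hb (x : bdry.{u} m) : False := hS.false x.down
    exact ⟨f, .refl f, ⟨fun x ↦ (hb x).elim, fun n p _ ↦ (hb (p 0)).elim⟩,
      fun x ↦ (hS.false x).elim⟩
  let M : Set (Coord m) := {0}ᶜ
  have hM : IsOpen M := isOpen_compl_singleton
  let F : Coord m → X := fun x ↦
    if hx : x = 0 then f x₀ else f ⟨‖x‖⁻¹ • x, by simp [norm_smul, hx]⟩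
  have hFM (x : Coord m) (hx : x ≠ 0) (hx' : ‖x‖⁻¹ • x ∈ Metric.sphere (0 : Coord m) 1) :
      F x = f ⟨‖x‖⁻¹ • x, hx'⟩ := dif_neg hx
  have hF : ContinuousOn F M := by
    rw [continuousOn_iff_continuous_domRestrict]
    have h1 : Continuous fun x : M ↦ ‖x.1‖⁻¹ :=
      Continuous.inv₀ (by fun_prop) fun x ↦ norm_ne_zero_iff.2 x.2
    have h2 (x : M) : ‖x.1‖⁻¹ • x.1 ∈ Metric.sphere (0 : Coord m) 1 := by
      have : x.1 ≠ 0 := x.2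
      simp [norm_smul, this]
    refine (f.continuous.comp ((h1.smul continuous_subtype_val).subtype_mk h2)).congr fun x ↦ ?_
    exact (hFM x.1 x.2 (h2 x)).symm
  obtain ⟨g, hg, H, hH, hHM⟩ := hX (M := M) (N := ∅) (A := ∅) (f := F) hM isOpen_empty
    (empty_subset _) (empty_subset _) (by simpa using hM) hF (by simp)
  have hSM (x : USphere (Coord m)) : x.1 ∈ M := fun h ↦ by
    have h1 := x.norm_eq
    rw [mem_singleton_iff.1 h, norm_zero] at h1
    exact zero_ne_one h1
  have hc : Continuous fun q : I × USphere (Coord m) ↦ H (q.2.1, q.1) :=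
    hH.comp_continuous (by fun_prop) fun q ↦ ⟨hSM q.2, mem_univ _⟩
  have hc1 : Continuous fun x : USphere (Coord m) ↦ g x :=
    (hc.comp (Continuous.prodMk_right (1 : I))).congr fun x ↦ (hHM x (hSM x)).2.1 1 le_rfl
  refine ⟨⟨fun x ↦ g x, hc1⟩, ⟨⟨⟨_, hc⟩, fun x ↦ ?_, fun x ↦ ?_⟩⟩,
    ⟨fun x ↦ g (bdryVal x), fun n p hp ↦ ?_⟩, fun x ↦ rfl⟩
  · refine ((hHM x (hSM x)).1 0 le_rfl).trans ?_
    rw [hFM x.1 (hSM x) (by simp)]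
    congr 1
    ext1
    simp
  · exact (hHM x (hSM x)).2.1 1 le_rfl
  · refine isPlot_iff_plotAt.2 fun y ↦ ?_
    exact (hg _ (hSM (p y).down)).comp_contDiff (bdry.isPlot_iff.1 hp)

/-! ### Attaching disks to topological spaces -/

/-- A presentation of `i : A ⟶ A'` as the inclusion of a space in the space obtained from it by
attaching `m`-disks, by its universal property. -/
structure DiskAttachment {A A' : TopCat.{u}} (i : A ⟶ A') (m : ℕ) where
  /-- The index type of the disks. -/
  ι : Type u
  /-- The attaching maps. -/
  bd (α : ι) : C(USphere (Coord m), A)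
  /-- The characteristic maps. -/
  cell (α : ι) : C(UBall (Coord m), A')
  glue (α : ι) (x : USphere (Coord m)) : cell α (usphereIncl _ x) = i (bd α x)
  exists_desc {T : TopCat.{u}} (f : A ⟶ T) (g : ι → C(UBall (Coord m), T))
    (hfg : ∀ α x, g α (usphereIncl _ x) = f (bd α x)) :
    ∃ l : A' ⟶ T, i ≫ l = f ∧ ∀ α x, l (cell α x) = g α x
  hom_ext {T : TopCat.{u}} {f g : A' ⟶ T} (h : i ≫ f = i ≫ g)
    (h' : ∀ α x, f (cell α x) = g (cell α x)) : f = g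

lemma HomotopicalAlgebra.AttachCells.nonempty_diskAttachment {A A' : TopCat.{u}}
    {i : A ⟶ A'} {m : ℕ}
    (c : HomotopicalAlgebra.AttachCells.{u} (TopCat.RelativeCWComplex.basicCell.{u} m) i) :
    Nonempty (DiskAttachment i m) := by
  let upS : C(USphere (Coord m), TopCat.diskBoundary.{u} m) := ⟨ULift.up, continuous_uliftUp⟩
  let upB : C(UBall (Coord m), TopCat.disk.{u} m) := ⟨ULift.up, continuous_uliftUp⟩
  have hc (α : c.ι) (x : TopCat.diskBoundary.{u} m) :
      c.m (c.cofan₁.inj α x) = c.cofan₂.inj α (TopCat.diskBoundaryInclusion m x) :=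
    ConcreteCategory.congr_hom (c.hm α) x
  have hw (y : c.cofan₁.pt) : i (c.g₁ y) = c.g₂ (c.m y) :=
    ConcreteCategory.congr_hom c.isPushout.w y
  refine ⟨⟨c.ι, fun α ↦ (c.cofan₁.inj α ≫ c.g₁).hom.comp upS, fun α ↦ (c.cell α).hom.comp upB,
    fun α x ↦ ?_, fun {T} f g hfg ↦ ?_, fun h h' ↦ c.hom_ext h fun α ↦ ?_⟩⟩
  · exact ((hw _).trans (congrArg c.g₂ (hc α ⟨x⟩))).symm
  · let G (α : c.ι) : TopCat.disk.{u} m ⟶ T :=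
      TopCat.ofHom ((g α).comp ⟨ULift.down, continuous_uliftDown⟩)
    let g' : c.cofan₂.pt ⟶ T := Cofan.IsColimit.desc c.isColimit₂ G
    have hg' (α) : c.cofan₂.inj α ≫ g' = G α := Cofan.IsColimit.fac c.isColimit₂ G α
    have hfg' : c.g₁ ≫ f = c.m ≫ g' := by
      refine Cofan.IsColimit.hom_ext c.isColimit₁ _ _ fun α ↦ ?_
      ext x
      have h1 := ConcreteCategory.congr_hom (hg' α) (TopCat.diskBoundaryInclusion m x)
      change f (c.g₁ (c.cofan₁.inj α x)) = g' (c.m (c.cofan₁.inj α x))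
      rw [hc]
      exact ((h1.trans (hfg α x.down))).symm
    refine ⟨c.isPushout.desc f g' hfg', c.isPushout.inl_desc _ _ _, fun α x ↦ ?_⟩
    have h1 : c.cell α ≫ c.isPushout.desc f g' hfg' = G α := by
      rw [HomotopicalAlgebra.AttachCells.cell_def, Category.assoc, c.isPushout.inr_desc, hg']
    exact ConcreteCategory.congr_hom h1 (ULift.up x)
  · ext x
    exact h' α x.down

/-! ### One step of the construction -/

/-- A lifting property of `j'` relative to `j`, for a square `i ≫ j' = j ≫ z`: a lift along `j`
extends to a lift along `j'`. -/
def RelCylAnodyne {A A' Z Z' : TopCat.{u}} (i : A ⟶ A') (j : A ⟶ Z) (j' : A' ⟶ Z') (z : Z ⟶ Z') :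
    Prop :=
  ∀ ⦃E B : TopCat.{u}⦄ (p : E ⟶ B), CylLift p.hom → ∀ (f : A' ⟶ E) (w : Z' ⟶ B) (l : Z ⟶ E),
    f ≫ p = j' ≫ w → j ≫ l = i ≫ f → l ≫ p = z ≫ w →
    ∃ l' : Z' ⟶ E, z ≫ l' = l ∧ j' ≫ l' = f ∧ l' ≫ p = w

lemma RelCylAnodyne.cylAnodyne {A A' Z Z' : TopCat.{u}} {i : A ⟶ A'} {j : A ⟶ Z} {j' : A' ⟶ Z'}
    {z : Z ⟶ Z'} (h : RelCylAnodyne i j j' z) (hj : CylAnodyne j) (hsq : i ≫ j' = j ≫ z) :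
    CylAnodyne j' := fun E B p hp f w hfw ↦ by
  obtain ⟨l, hl, hlp⟩ := hj p hp (i ≫ f) (z ≫ w) (by
    rw [Category.assoc, hfw, ← Category.assoc, hsq, Category.assoc])
  obtain ⟨l', -, hl', hlp'⟩ := h p hp f w l hfw hl hlp
  exact ⟨l', hl', hlp'⟩

/-- The D-topology functor to all topological spaces. -/
def dTopCat : DiffSpace.{u} ⥤ TopCat.{u} where
  obj X := TopCat.of X
  map f := TopCat.ofHom ⟨f.toFun, f.continuous⟩

/-- A presentation of `x : X ⟶ X'` as the inclusion of a diffeological space in the space obtained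
from it by attaching `m`-disks along smooth maps, by its universal property. -/
structure SmoothDiskAttachment {X X' : DiffSpace.{u}} (x : X ⟶ X') (m : ℕ) where
  /-- The index type of the disks. -/
  ι : Type u
  /-- The attaching maps. -/
  bd (α : ι) : DiffSpace.bdry m ⟶ X
  /-- The characteristic maps. -/
  cell (α : ι) : DiffSpace.disk m ⟶ X'
  glue (α : ι) : DiffSpace.bdryInclusion m ≫ cell α = bd α ≫ x
  exists_desc {T : DiffSpace.{u}} (f : X ⟶ T) (g : ι → (DiffSpace.disk m ⟶ T))
    (hfg : ∀ α, DiffSpace.bdryInclusion m ≫ g α = bd α ≫ f) :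
    ∃ l : X' ⟶ T, x ≫ l = f ∧ ∀ α, cell α ≫ l = g α
  hom_ext {T : DiffSpace.{u}} {f g : X' ⟶ T} (h : x ≫ f = x ≫ g)
    (h' : ∀ α, cell α ≫ f = cell α ≫ g) : f = g

namespace DiffSpace

/-- The universal property of `attach h`. -/
def attachSmoothDiskAttachment {X : DiffSpace.{u}} {ι : Type u} {m : ℕ}
    (h : ι → (bdry.{u} m ⟶ X)) : SmoothDiskAttachment (attachIncl h) m where
  ι := ι
  bd := h
  cell := attachCell h
  glue α := by
    ext x
    exact attachCell_bdry α x
  exists_desc {T} f g hfg := by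
    have hfg' (α : ι) (x : bdry.{u} m) :
        (g α).toFun ((bdryInclusion m).toFun x) = f.toFun ((h α).toFun x) :=
      congrArg (fun φ ↦ Hom.toFun φ x) (hfg α)
    have h1 (α : ι) (d : disk.{u} m) :=
      attachDesc_cell (f := f.toFun) (g := fun α ↦ (g α).toFun) hfg' α d
    refine ⟨⟨attachDesc h f.toFun fun α ↦ (g α).toFun, dSmooth_attach f.smooth fun α ↦ ?_⟩,
      rfl, fun α ↦ ?_⟩
    · rw [funext (h1 α)]
      exact (g α).smooth
    · ext d
      exact h1 α d
  hom_ext {T f g} hX hc := by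
    ext y
    obtain ⟨x, rfl⟩ | ⟨α, d, -, rfl⟩ := attach_cases y
    · exact congrArg (fun φ ↦ Hom.toFun φ x) hX
    · exact congrArg (fun φ ↦ Hom.toFun φ d) (hc α)

end DiffSpace

/-- Spaces `X` and `Z` with maps `A ⟶ Z ⟵ X`, as they occur in the inductive construction of a
smooth CW complex homotopy equivalent to a given CW complex with skeleton `A`. -/
structure Stage (A : TopCat.{u}) where
  /-- The skeleton of a smooth CW complex. -/
  X : DiffSpace.{u}
  /-- The space to which `A` and `X` are compared. -/
  Z : TopCat.{u}
  /-- The map from the given skeleton. -/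
  j : A ⟶ Z
  /-- The map from the smooth skeleton. -/
  k : dTopCat.obj X ⟶ Z
  cylAnodyne_k : CylAnodyne k
  smoothApprox : X.SmoothApprox

/-- The relation between two successive stages. -/
structure StageStep {A A' : TopCat.{u}} (i : A ⟶ A') (m : ℕ) (S : Stage A) (S' : Stage A') where
  /-- The map between the smooth skeleta. -/
  x : S.X ⟶ S'.X
  /-- The map between the comparison spaces. -/
  z : S.Z ⟶ S'.Z
  comm_j : i ≫ S'.j = S.j ≫ z
  comm_k : dTopCat.map x ≫ S'.k = S.k ≫ z
  rel_j : RelCylAnodyne i S.j S'.j z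
  rel_k : RelCylAnodyne (dTopCat.map x) S.k S'.k z
  /-- The smooth skeleton grows by the attachment of disks. -/
  attachment : SmoothDiskAttachment x m

lemma Stage.exists_step {A A' : TopCat.{u}} {i : A ⟶ A'} {m : ℕ} (S : Stage A)
    (d : DiskAttachment i m) : ∃ S' : Stage A', Nonempty (StageStep i m S S') := by
  obtain ⟨r, -, H, hH⟩ := S.cylAnodyne_k.exists_retraction
  let f (α : d.ι) : C(USphere (Coord m), S.X) := r.hom.comp (S.j.hom.comp (d.bd α))
  choose g hfg h hh using fun α ↦ S.smoothApprox.exists_homotopic_smooth (f α)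
  have h1 (α : d.ι) : (S.j.hom.comp (d.bd α)).Homotopic (S.k.hom.comp (f α)) :=
    ⟨⟨⟨fun q ↦ H (S.j (d.bd α q.2), q.1), by fun_prop⟩, fun x ↦ (hH _).1, fun x ↦ (hH _).2⟩⟩
  have h2 (α : d.ι) : ∃ K : C(USphere (Coord m) × I, S.Z), (∀ x, K (x, 0) = S.j (d.bd α x)) ∧
      ∀ x, K (x, 1) = S.k (g α x) := by
    obtain ⟨G⟩ := (h1 α).trans ((ContinuousMap.Homotopic.refl S.k.hom).comp (hfg α))
    exact ⟨⟨fun q ↦ G (q.2, q.1), by fun_prop⟩, G.map_zero_left, G.map_one_left⟩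
  choose K hK0 hK1 using h2
  let T := attachCyl K
  obtain ⟨j', hj', hj'c⟩ := d.exists_desc (S.j ≫ attachCylIncl K)
    (fun α ↦ (attachCylCell K α).comp ⟨fun x ↦ (x, 0), by fun_prop⟩) (fun α x ↦ by
      refine (attachCyl_glue α x 0).trans ?_
      rw [hK0]
      rfl)
  let c (α : d.ι) (y : DiffSpace.disk.{u} m) : T :=
    attachCylCell K α (⟨DiffSpace.diskVal y, by simpa using DiffSpace.disk.norm_val_le y⟩, 1)
  let k₀ : DiffSpace.attach h → T := DiffSpace.attachDesc h (fun x ↦ attachCylIncl K (S.k x)) c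
  have hk₀ (α : d.ι) (y : DiffSpace.disk.{u} m) :
      k₀ ((DiffSpace.attachCell h α).toFun y) = c α y := by
    refine DiffSpace.attachDesc_cell (fun α x ↦ ?_) α y
    have h3 := attachCyl_glue (K := K) α ⟨DiffSpace.bdryVal x, by simp⟩ 1
    refine h3.trans ?_
    rw [hK1, ← hh]
    rfl
  have hk₀c : Continuous k₀ := by
    refine DiffSpace.continuous_attach (S.k ≫ attachCylIncl K).hom.continuous fun α ↦ ?_
    rw [funext (hk₀ α), DiffSpace.disk.continuous_iff]
    exact (attachCylCell K α).continuous.comp (.prodMk_left 1)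
  let k' : dTopCat.obj (DiffSpace.attach h) ⟶ T := TopCat.ofHom ⟨k₀, hk₀c⟩
  have comm_k : dTopCat.map (DiffSpace.attachIncl h) ≫ k' = S.k ≫ attachCylIncl K := rfl
  have rel_k : RelCylAnodyne (dTopCat.map (DiffSpace.attachIncl h)) S.k k' (attachCylIncl K) := by
    intro E B p hp f w l hfw hlf hlw
    have hfw' (y : DiffSpace.attach h) : p (f y) = w (k₀ y) := ConcreteCategory.congr_hom hfw y
    have hlf' (x : S.X) : l (S.k x) = f ((DiffSpace.attachIncl h).toFun x) :=
      ConcreteCategory.congr_hom hlf x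
    have hfc (α : d.ι) : Continuous (f ∘ (DiffSpace.attachCell h α).toFun) :=
      f.hom.continuous.comp (DiffSpace.Hom.continuous _)
    obtain ⟨l', h3, h4, h5⟩ := attachCyl_exists_lift hp (.inr rfl) hlw
      (fun α ↦ ⟨_, DiffSpace.disk.continuous_iff.1 (hfc α)⟩) (fun α x ↦ by
        rw [hK1, hlf', ← hh, ← DiffSpace.attachCell_bdry]
        rfl) (fun α x ↦ by
        refine (hfw' _).trans ?_
        exact congrArg w (hk₀ α _))
    refine ⟨l', h3, ?_, h4⟩
    ext y
    change l' (k₀ y) = f y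
    obtain ⟨x, rfl⟩ | ⟨α, y, -, rfl⟩ := DiffSpace.attach_cases (h := h) y
    · rw [← hlf', ← h3]
      rfl
    · rw [hk₀]
      exact h5 α _
  have rel_j : RelCylAnodyne i S.j j' (attachCylIncl K) := by
    intro E B p hp f w l hfw hlf hlw
    have hfw' (y : A') : p (f y) = w (j' y) := ConcreteCategory.congr_hom hfw y
    have hlf' (x : A) : l (S.j x) = f (i x) := ConcreteCategory.congr_hom hlf x
    obtain ⟨l', h3, h4, h5⟩ := attachCyl_exists_lift hp (.inl rfl) hlw
      (fun α ↦ f.hom.comp (d.cell α)) (fun α x ↦ by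
        rw [hK0, hlf', ← d.glue]
        rfl) (fun α x ↦ by
        refine (hfw' _).trans ?_
        rw [hj'c]
        rfl)
    refine ⟨l', h3, d.hom_ext ?_ fun α x ↦ ?_, h4⟩
    · rw [← Category.assoc, hj', Category.assoc, h3, hlf]
    · change l' (j' _) = _
      rw [hj'c]
      exact h5 α x
  exact ⟨⟨_, T, j', k', rel_k.cylAnodyne S.cylAnodyne_k comm_k, S.smoothApprox.attach⟩,
    ⟨⟨DiffSpace.attachIncl h, attachCylIncl K, hj', comm_k, rel_j, rel_k,
      DiffSpace.attachSmoothDiskAttachment h⟩⟩⟩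

/-! ### Colimits of sequences -/

/-- Sequences obeying a relation between successive terms can be constructed recursively. -/
lemma exists_seq_of_step {L : ℕ → Type*} {R : ∀ n, L n → L (n + 1) → Prop} (l₀ : L 0)
    (step : ∀ n l, ∃ l', R n l l') : ∃ l : ∀ n, L n, l 0 = l₀ ∧ ∀ n, R n (l n) (l (n + 1)) := by
  choose s hs using step
  exact ⟨fun n ↦ Nat.rec l₀ s n, rfl, fun n ↦ hs n _⟩

/-- The universal property of the colimit of a sequence of morphisms `f n : X n ⟶ X (n + 1)`. -/
structure IsSeqColimit {C : Type*} [Category* C] {X : ℕ → C} (f : ∀ n, X n ⟶ X (n + 1)) {Y : C}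
    (e : ∀ n, X n ⟶ Y) : Prop where
  comm (n : ℕ) : f n ≫ e (n + 1) = e n
  exists_desc {T : C} (g : ∀ n, X n ⟶ T) (hg : ∀ n, f n ≫ g (n + 1) = g n) :
    ∃ l : Y ⟶ T, ∀ n, e n ≫ l = g n
  hom_ext {T : C} {g g' : Y ⟶ T} (h : ∀ n, e n ≫ g = e n ≫ g') : g = g'

namespace IsSeqColimit

variable {C : Type*} [Category* C]

lemma of_isColimit {F : ℕ ⥤ C} {c : Cocone F} (hc : IsColimit c) :
    IsSeqColimit (fun n ↦ F.map (homOfLE (n.le_add_right 1))) c.ι.app where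
  comm n := c.w _
  exists_desc {T} g hg :=
    ⟨hc.desc ⟨T, NatTrans.ofSequence g fun n ↦ by simpa using hg n⟩, fun n ↦ hc.fac _ n⟩
  hom_ext h := hc.hom_ext h

variable {X : ℕ → C} {f : ∀ n, X n ⟶ X (n + 1)} {Y : C} {e : ∀ n, X n ⟶ Y}

lemma shift (h : IsSeqColimit f e) : IsSeqColimit (fun n ↦ f (n + 1)) (fun n ↦ e (n + 1)) where
  comm n := h.comm (n + 1)
  exists_desc g hg := by
    obtain ⟨l, hl⟩ := h.exists_desc (fun | 0 => f 0 ≫ g 0 | n + 1 => g n)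
      (fun | 0 => rfl | n + 1 => hg n)
    exact ⟨l, fun n ↦ hl (n + 1)⟩
  hom_ext hgg' := h.hom_ext fun
    | 0 => by rw [← h.comm, Category.assoc, hgg', Category.assoc]
    | n + 1 => hgg' n

lemma ofSequence_comm (h : IsSeqColimit f e) (n : ℕ) :
    (Functor.ofSequence f).map (homOfLE (n.le_add_right 1)) ≫ e (n + 1) =
      e n ≫ ((Functor.const ℕ).obj Y).map (homOfLE (n.le_add_right 1)) := by
  rw [Functor.ofSequence_map_homOfLE_succ]
  exact (h.comm n).trans (Category.comp_id _).symm

/-- The corresponding colimit cocone on a functor. -/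
def isColimit (h : IsSeqColimit f e) :
    IsColimit (Cocone.mk (F := Functor.ofSequence f) Y (NatTrans.ofSequence e h.ofSequence_comm)) :=
  have hs (s : Cocone (Functor.ofSequence f)) : ∃ l : Y ⟶ s.pt, ∀ n, e n ≫ l = s.ι.app n :=
    h.exists_desc s.ι.app fun n ↦ by
      rw [← s.w (homOfLE (n.le_add_right 1)), Functor.ofSequence_map_homOfLE_succ]
      rfl
  { desc s := (hs s).choose
    fac s n := (hs s).choose_spec n
    uniq s l hl := h.hom_ext fun n ↦ (hl n).trans ((hs s).choose_spec n).symm }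

end IsSeqColimit

lemma TopCat.exists_isSeqColimit {Z : ℕ → TopCat.{u}} (z : ∀ n, Z n ⟶ Z (n + 1)) :
    ∃ (Y : TopCat.{u}) (e : ∀ n, Z n ⟶ Y), IsSeqColimit z e := by
  refine ⟨colimit (Functor.ofSequence z), colimit.ι (Functor.ofSequence z), ?_⟩
  have := IsSeqColimit.of_isColimit (colimit.isColimit (Functor.ofSequence z))
  simpa only [Functor.ofSequence_map_homOfLE_succ] using! this

/-- The colimit of a sequence of maps with the relative lifting property has the lifting
property. -/
lemma CylAnodyne.of_isSeqColimit {A Z : ℕ → TopCat.{u}} {i : ∀ n, A n ⟶ A (n + 1)}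
    {z : ∀ n, Z n ⟶ Z (n + 1)} {j : ∀ n, A n ⟶ Z n} (hj₀ : CylAnodyne (j 0))
    (hj : ∀ n, RelCylAnodyne (i n) (j n) (j (n + 1)) (z n))
    {A' Z' : TopCat.{u}} {a : ∀ n, A n ⟶ A'} {ζ : ∀ n, Z n ⟶ Z'}
    (hia : ∀ n, i n ≫ a (n + 1) = a n)
    (ha : ∀ ⦃T : TopCat.{u}⦄ (g g' : A' ⟶ T), (∀ n, a n ≫ g = a n ≫ g') → g = g')
    (hζ : IsSeqColimit z ζ) {j' : A' ⟶ Z'} (hj' : ∀ n, a n ≫ j' = j n ≫ ζ n) :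
    CylAnodyne j' := by
  intro E B p hp f w hfw
  have hfw' (n : ℕ) : (a n ≫ f) ≫ p = j n ≫ ζ n ≫ w := by
    rw [Category.assoc, hfw, ← Category.assoc, hj', Category.assoc]
  let L (n : ℕ) : Type _ := {l : Z n ⟶ E // j n ≫ l = a n ≫ f ∧ l ≫ p = ζ n ≫ w}
  obtain ⟨l₀, hl₀, hl₀p⟩ := hj₀ p hp _ _ (hfw' 0)
  obtain ⟨l, -, hl⟩ := exists_seq_of_step (L := L) (R := fun n l l' ↦ z n ≫ l'.1 = l.1)
    ⟨l₀, hl₀, hl₀p⟩ fun n l ↦ by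
      obtain ⟨l', h1, h2, h3⟩ := hj n p hp (a (n + 1) ≫ f) (ζ (n + 1) ≫ w) l.1 (hfw' (n + 1))
        (by rw [l.2.1, ← hia, Category.assoc]) (by rw [l.2.2, ← hζ.comm, Category.assoc])
      exact ⟨⟨l', h2, h3⟩, h1⟩
  obtain ⟨m, hm⟩ := hζ.exists_desc (fun n ↦ (l n).1) hl
  refine ⟨m, ha _ _ fun n ↦ ?_, hζ.hom_ext fun n ↦ ?_⟩
  · rw [← Category.assoc, hj', Category.assoc, hm, (l n).2.1]
  · rw [← Category.assoc, hm, (l n).2.2]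

namespace DiffSpace

/-- Sequences of diffeological spaces have a colimit, and its D-topology is the colimit of the
D-topologies. -/
lemma exists_isSeqColimit {X : ℕ → DiffSpace.{u}} (x : ∀ n, X n ⟶ X (n + 1)) :
    ∃ (Y : DiffSpace.{u}) (e : ∀ n, X n ⟶ Y), IsSeqColimit x e ∧
      IsSeqColimit (fun n ↦ dTopCat.map (x n)) (fun n ↦ dTopCat.map (e n)) := by
  let r (p q : Σ n, X n) : Prop := ∃ n a, p = ⟨n, a⟩ ∧ q = ⟨n + 1, (x n).toFun a⟩
  let φ (n : ℕ) (a : X n) : Quot r := Quot.mk r ⟨n, a⟩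
  have hφ (y : Quot r) : ∃ n a, φ n a = y := by
    induction y using Quot.ind with
    | mk p => exact ⟨p.1, p.2, rfl⟩
  have hφx (n : ℕ) (a : X n) : φ (n + 1) ((x n).toFun a) = φ n a :=
    (Quot.sound ⟨n, a, rfl, rfl⟩).symm
  have desc {T : Type u} (g : ∀ n, X n → T) (hg : ∀ n a, g (n + 1) ((x n).toFun a) = g n a) :
      ∃ l : glued X φ hφ → T, ∀ n a, l ((toGlued X φ hφ n).toFun a) = g n a := by
    refine ⟨Quot.lift (fun p ↦ g p.1 p.2) ?_, fun n a ↦ rfl⟩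
    rintro _ _ ⟨n, a, rfl, rfl⟩
    exact (hg n a).symm
  refine ⟨glued X φ hφ, toGlued X φ hφ, ⟨fun n ↦ ?_, fun {T} g hg ↦ ?_, fun {T g g'} h ↦ ?_⟩,
    ⟨fun n ↦ ?_, fun {T} g hg ↦ ?_, fun {T g g'} h ↦ ?_⟩⟩
  · ext a
    exact hφx n a
  · obtain ⟨l, hl⟩ := desc (fun n ↦ (g n).toFun) fun n a ↦ congrArg (fun f ↦ Hom.toFun f a) (hg n)
    refine ⟨⟨l, dSmooth_glued fun n ↦ ?_⟩, fun n ↦ ?_⟩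
    · rw [funext (hl n)]
      exact (g n).smooth
    · ext a
      exact hl n a
  · ext y
    obtain ⟨n, a, rfl⟩ := hφ y
    exact congrArg (fun f ↦ Hom.toFun f a) (h n)
  · ext a
    exact hφx n a
  · obtain ⟨l, hl⟩ := desc (fun n a ↦ g n a) fun n a ↦ ConcreteCategory.congr_hom (hg n) a
    refine ⟨TopCat.ofHom ⟨l, continuous_glued.2 fun n ↦ ?_⟩, fun n ↦ ?_⟩
    · rw [funext (hl n)]
      exact (g n).hom.continuous
    · ext a
      exact hl n a
  · ext y
    obtain ⟨n, a, rfl⟩ := hφ y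
    exact ConcreteCategory.congr_hom (h n) a

/-! ### Smooth CW complexes from attachments of disks -/

/-- The coproduct of a family of diffeological spaces. -/
def sigmaCofan {J : Type u} (A : J → DiffSpace.{u}) : Cofan A :=
  Cofan.mk (glued A (fun j a ↦ (⟨j, a⟩ : Σ j, A j)) fun p ↦ ⟨p.1, p.2, rfl⟩) (toGlued A _ _)

/-- The universal property of the coproduct. -/
def isColimitSigmaCofan {J : Type u} (A : J → DiffSpace.{u}) : IsColimit (sigmaCofan A) :=
  Cofan.IsColimit.mk _
    (fun t ↦ ⟨fun p ↦ (t.inj p.1).toFun p.2, dSmooth_glued fun j ↦ (t.inj j).smooth⟩)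
    (fun t j ↦ rfl) fun t m hm ↦ by
      ext p
      exact congrArg (fun f ↦ Hom.toFun f p.2) (hm p.1)

end DiffSpace

lemma SmoothDiskAttachment.nonempty_attachCells {X X' : DiffSpace.{u}} {x : X ⟶ X'} {n : ℕ}
    (d : SmoothDiskAttachment x (n + 1)) :
    Nonempty (HomotopicalAlgebra.AttachCells.{u} (fun _ : Unit ↦ DiffSpace.sphereInclusion.{u} n)
      x) := by
  have h₁ := DiffSpace.isColimitSigmaCofan fun _ : d.ι ↦ DiffSpace.sphere.{u} n
  have h₂ := DiffSpace.isColimitSigmaCofan fun _ : d.ι ↦ DiffSpace.disk.{u} (n + 1)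
  let D : Cofan fun _ : d.ι ↦ DiffSpace.disk.{u} (n + 1) := DiffSpace.sigmaCofan _
  let c (α : d.ι) : DiffSpace.sphere.{u} n ⟶ D.pt := DiffSpace.sphereInclusion n ≫ D.inj α
  let m := Cofan.IsColimit.desc h₁ c
  let g₁ := Cofan.IsColimit.desc h₁ d.bd
  let g₂ := Cofan.IsColimit.desc h₂ d.cell
  have hm (α : d.ι) := Cofan.IsColimit.fac h₁ c α
  have hg₁ (α : d.ι) := Cofan.IsColimit.fac h₁ d.bd α
  have hg₂ (α : d.ι) := Cofan.IsColimit.fac h₂ d.cell α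
  have w : g₁ ≫ x = m ≫ g₂ := by
    refine Cofan.IsColimit.hom_ext h₁ _ _ fun α ↦ ?_
    rw [← Category.assoc, ← Category.assoc, hg₁, hm]
    change _ = (DiffSpace.sphereInclusion n ≫ D.inj α) ≫ g₂
    rw [Category.assoc, hg₂]
    exact (d.glue α).symm
  have hs (s : PushoutCocone g₁ m) : ∃ l : X' ⟶ s.pt, x ≫ l = s.inl ∧ g₂ ≫ l = s.inr := by
    obtain ⟨l, hl, hlc⟩ := d.exists_desc s.inl (fun α ↦ D.inj α ≫ s.inr)
      fun α ↦ by
        have := congrArg (Cofan.inj _ α ≫ ·) s.condition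
        rw [← Category.assoc, ← Category.assoc, hg₁, hm, Category.assoc] at this
        exact this.symm
    refine ⟨l, hl, Cofan.IsColimit.hom_ext h₂ _ _ fun α ↦ ?_⟩
    rw [← Category.assoc, hg₂, hlc]
  choose l hl hlr using hs
  refine ⟨⟨d.ι, fun _ ↦ (), _, _, h₁, h₂, m, hm, g₁, g₂, ⟨⟨w⟩,
    ⟨PushoutCocone.IsColimit.mk w l hl hlr fun s m' hm' hm'' ↦
      d.hom_ext (hm'.trans (hl s).symm) fun α ↦ ?_⟩⟩⟩⟩
  rw [← hg₂, Category.assoc, Category.assoc]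
  exact congrArg _ (hm''.trans (hlr s).symm)

/-- Attaching `0`-disks to the empty space gives a discrete space: by the universal property, its
identity factors through the discrete diffeology. -/
lemma SmoothDiskAttachment.isDiscreteDiffeology {X X' : DiffSpace.{u}} {x : X ⟶ X'} [IsEmpty X]
    (d : SmoothDiskAttachment x 0) : IsDiscreteDiffeology X' := by
  let P : DiffSpace.{u} := DiffSpace.disk 0
  have hP (p q : P) : p = q := DiffSpace.disk.ext (Subsingleton.elim _ _)
  let T := DiffSpace.glued (fun _ : X' ↦ P) (fun y _ ↦ y) fun y ↦
    ⟨y, DiffSpace.disk.mk 0 (by simp), rfl⟩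
  let c (α : d.ι) : P ⟶ T :=
    ⟨fun p ↦ ((d.cell α).toFun p : X'), fun n p hp ↦ DiffSpace.isPlot_glued.2 fun z ↦
      ⟨(d.cell α).toFun (p z), p, hp, .of_forall fun y ↦ by
        change (d.cell α).toFun (p y) = (d.cell α).toFun (p z)
        rw [hP (p y) (p z)]⟩⟩
  obtain ⟨l, -, hl⟩ := d.exists_desc (T := T) ⟨fun a ↦ isEmptyElim a, fun n p ↦ isEmptyElim (p 0)⟩ c
    fun α ↦ by
      ext y
      exact isEmptyElim ((d.bd α).toFun y)
  let q : T ⟶ X' := ⟨fun y ↦ y, DiffSpace.dSmooth_glued fun y n p hp ↦ isPlot_const⟩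
  have hlq : l ≫ q = 𝟙 X' := by
    refine d.hom_ext (by ext a; exact isEmptyElim a) fun α ↦ ?_
    rw [← Category.assoc, hl]
    rfl
  intro n p hp
  rw [IsLocallyConstant.iff_eventually_eq]
  intro z
  obtain ⟨y, g, -, hg⟩ := DiffSpace.isPlot_glued.1 (l.smooth n p hp) z
  have hlp (a) : (l.toFun (p a) : X') = p a := congrArg (fun f ↦ DiffSpace.Hom.toFun f (p a)) hlq
  filter_upwards [hg] with a ha
  rw [← hlp a, ← hlp z]
  exact ha.trans hg.eq_of_nhds.symm

lemma SmoothDiskAttachment.nonempty_smoothCWComplex {X : ℕ → DiffSpace.{u}}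
    {x : ∀ n, X n ⟶ X (n + 1)} [IsEmpty (X 0)] (d : ∀ n, SmoothDiskAttachment (x n) n)
    {Y : DiffSpace.{u}} {e : ∀ n, X n ⟶ Y} (he : IsSeqColimit x e) :
    Nonempty (DiffSpace.SmoothCWComplex Y) := by
  have h (n : ℕ) := (d (n + 1)).nonempty_attachCells
  exact ⟨⟨Functor.ofSequence fun n ↦ x (n + 1), (d 0).isDiscreteDiffeology, fun n ↦
    (Functor.ofSequence_map_homOfLE_succ (fun n ↦ x (n + 1)) n).symm ▸ (h n).some, _,
    he.shift.isColimit⟩⟩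

/-! ### CW complexes are delta-generated -/

/-- A space is delta-generated if its identity factors through the associated delta-generated
space. -/
lemma deltaGeneratedSpace_of_section {A : TopCat.{u}}
    (s : A ⟶ TopCat.of (DeltaGeneratedSpace.of (Y := A)))
    (hs : s ≫ TopCat.ofHom ⟨_, WithGeneratedByTopology.continuous_equiv⟩ = 𝟙 A) :
    DeltaGeneratedSpace A := by
  refine ⟨s.hom.continuous.congr fun y ↦ ?_⟩
  rw [Equiv.eq_symm_apply]
  exact ConcreteCategory.congr_hom hs y

lemma deltaGeneratedSpace_uball (m : ℕ) : DeltaGeneratedSpace (UBall (Coord m)) := by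
  let r : (Fin m → ℝ) → UBall (Coord m) := fun v ↦
    ⟨(max 1 ‖WithLp.toLp 2 v‖)⁻¹ • WithLp.toLp 2 v, by
      simpa using DiffSpace.diskClamp_norm_le (WithLp.toLp 2 v : Coord m)⟩
  have hr : Continuous r := by
    refine Continuous.subtype_mk (Continuous.smul (Continuous.inv₀ (continuous_const.max
      (PiLp.continuous_toLp 2 _).norm) fun v ↦ ?_) (PiLp.continuous_toLp 2 _)) _
    exact (lt_max_of_lt_left one_pos).ne'
  have hq : IsQuotientMap r := .of_inverse (f := fun x : UBall (Coord m) ↦ WithLp.ofLp x.1)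
    (by fun_prop) hr fun x ↦ by
    simp [r, x.norm_le]
  exact hq.isGeneratedBy

/-- A continuous map on a delta-generated space is continuous for the associated delta-generated
topology on its target. -/
def liftDeltaGenerated {A B : Type*} [TopologicalSpace A] [TopologicalSpace B]
    [DeltaGeneratedSpace A] (f : C(A, B)) : C(A, DeltaGeneratedSpace.of (Y := B)) :=
  ⟨WithGeneratedByTopology.equiv.symm ∘ f,
    (IsGeneratedBy.equiv_symm_comp_continuous_iff (fun n ↦ Fin n → ℝ) f).2 f.continuous⟩

lemma DiskAttachment.deltaGeneratedSpace {A A' : TopCat.{u}} {i : A ⟶ A'} {m : ℕ}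
    (d : DiskAttachment i m) [DeltaGeneratedSpace A] : DeltaGeneratedSpace A' := by
  have := deltaGeneratedSpace_uball m
  obtain ⟨s, hs, hsc⟩ := d.exists_desc (T := TopCat.of (DeltaGeneratedSpace.of (Y := A')))
    (TopCat.ofHom (liftDeltaGenerated (B := A') i.hom))
    (fun α ↦ liftDeltaGenerated (B := A') (d.cell α))
    fun α x ↦ congrArg WithGeneratedByTopology.equiv.symm (d.glue α x)
  refine deltaGeneratedSpace_of_section s (d.hom_ext ?_ fun α x ↦ ?_)
  · rw [← Category.assoc, hs]
    rfl
  · exact congrArg (WithGeneratedByTopology.equiv (X := fun n ↦ Fin n → ℝ)) (hsc α x)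

lemma IsSeqColimit.deltaGeneratedSpace {A : ℕ → TopCat.{u}} {i : ∀ n, A n ⟶ A (n + 1)}
    {Y : TopCat.{u}} {e : ∀ n, A n ⟶ Y} (he : IsSeqColimit i e)
    (hA : ∀ n, DeltaGeneratedSpace (A n)) : DeltaGeneratedSpace Y := by
  let g (n : ℕ) : C(A n, DeltaGeneratedSpace.of (Y := Y)) := liftDeltaGenerated (e n).hom
  obtain ⟨s, hs⟩ := he.exists_desc (fun n ↦ TopCat.ofHom (g n)) fun n ↦ by
    ext a
    exact congrArg (WithGeneratedByTopology.equiv (X := fun n ↦ Fin n → ℝ) (Y := Y)).symm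
      (ConcreteCategory.congr_hom (he.comm n) a)
  refine deltaGeneratedSpace_of_section s (he.hom_ext fun n ↦ ?_)
  rw [← Category.assoc, hs]
  rfl

/-! ### Homotopy equivalences of delta-generated spaces -/

/-- Homotopies parametrized by the unit interval, for the usual product topology, give homotopies
of morphisms of delta-generated spaces. -/
lemma DeltaGenerated.homotopic_of_continuousMap {A B : Type u} [TopologicalSpace A]
    [DeltaGeneratedSpace A] [TopologicalSpace B] [DeltaGeneratedSpace B]
    {f g : DeltaGenerated.of A ⟶ DeltaGenerated.of B} (H : C(A × I, B))
    (hf : ∀ x : A, H (x, 0) = f x) (hg : ∀ x : A, H (x, 1) = g x) : Homotopic f g := by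
  let c : C(A × ℝ, A × I) := ⟨fun q ↦ (q.1, projIcc 0 1 zero_le_one (2 * q.2 - 1 / 2)),
    continuous_fst.prodMk (continuous_projIcc.comp (by fun_prop))⟩
  let K : C(DeltaGeneratedSpace.of (Y := A × ℝ), B) :=
    (H.comp c).comp ⟨_, WithGeneratedByTopology.continuous_equiv⟩
  refine ⟨ObjectProperty.homMk (TopCat.ofHom K), 1 / 4, by norm_num, by norm_num,
    fun x t ↦ ⟨fun ht ↦ ?_, fun ht ↦ ?_⟩⟩
  · change H (x, projIcc 0 1 zero_le_one (2 * t - 1 / 2)) = _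
    rw [projIcc_of_le_left _ (by linarith)]
    exact hf x
  · change H (x, projIcc 0 1 zero_le_one (2 * t - 1 / 2)) = _
    rw [projIcc_of_right_le _ (by linarith)]
    exact hg x

/-- Two spaces which are included in a third one by maps with the lifting property are homotopy
equivalent: both are deformation retracts. -/
lemma DeltaGenerated.homotopyEquivalent_of_cylAnodyne {A B Z : TopCat.{u}} [DeltaGeneratedSpace A]
    [DeltaGeneratedSpace B] {i : A ⟶ Z} {j : B ⟶ Z} (hi : CylAnodyne i) (hj : CylAnodyne j) :
    HomotopyEquivalent (DeltaGenerated.of A) (DeltaGenerated.of B) := by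
  obtain ⟨r, hr, H, hH⟩ := hi.exists_retraction
  obtain ⟨s, hs, K, hK⟩ := hj.exists_retraction
  have hr' (a : A) : r (i a) = a := ConcreteCategory.congr_hom hr a
  have hs' (b : B) : s (j b) = b := ConcreteCategory.congr_hom hs b
  refine ⟨ObjectProperty.homMk (i ≫ s), ObjectProperty.homMk (j ≫ r),
    homotopic_of_continuousMap ⟨fun q ↦ r (K (i q.1, unitInterval.symm q.2)), by fun_prop⟩ ?_ ?_,
    homotopic_of_continuousMap ⟨fun q ↦ s (H (j q.1, unitInterval.symm q.2)), by fun_prop⟩ ?_ ?_⟩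
  · intro x
    change r (K (i x, unitInterval.symm 0)) = r (j (s (i x)))
    rw [unitInterval.symm_zero, (hK _).2]
  · intro x
    change r (K (i x, unitInterval.symm 1)) = x
    rw [unitInterval.symm_one, (hK _).1, hr']
  · intro x
    change s (H (j x, unitInterval.symm 0)) = s (i (r (j x)))
    rw [unitInterval.symm_zero, (hH _).2]
  · intro x
    change s (H (j x, unitInterval.symm 1)) = x
    rw [unitInterval.symm_one, (hH _).1, hs']

/-! ### Smooth approximation of CW complexes -/

lemma TopCat.hom_ext_of_isEmpty {A B : TopCat.{u}} [IsEmpty A] (f g : A ⟶ B) : f = g := by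
  ext a
  exact isEmptyElim a

lemma CylAnodyne.of_isEmpty {A Z : TopCat.{u}} [IsEmpty A] [IsEmpty Z] (i : A ⟶ Z) :
    CylAnodyne i := fun _ _ _ _ _ _ _ ↦
  ⟨TopCat.ofHom ⟨fun z ↦ isEmptyElim z, continuous_iff_continuousAt.2 fun z ↦ isEmptyElim z⟩,
    TopCat.hom_ext_of_isEmpty _ _, TopCat.hom_ext_of_isEmpty _ _⟩

/-- The initial stage of the construction, in which all spaces are empty. -/
lemma Stage.exists_of_isEmpty (A : TopCat.{u}) [IsEmpty A] :
    ∃ S : Stage A, IsEmpty S.X ∧ CylAnodyne S.j := by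
  let E : DiffSpace.{u} := DiffSpace.glued (J := PEmpty.{1}) (X := PEmpty.{u + 1})
    (fun _ ↦ DiffSpace.disk 0) (fun j ↦ j.elim) fun x ↦ x.elim
  have hE : IsEmpty E := inferInstanceAs (IsEmpty PEmpty)
  have hE' : IsEmpty (dTopCat.obj E) := hE
  exact ⟨⟨E, A, 𝟙 A,
    TopCat.ofHom ⟨fun x : E ↦ isEmptyElim x, continuous_iff_continuousAt.2 fun x ↦ isEmptyElim x⟩,
    .of_isEmpty _, DiffSpace.smoothApprox_of_isEmpty E⟩, hE, .of_isEmpty _⟩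

/-- A space obtained from the empty space by successive attachments of disks is homotopy equivalent
to a smooth CW complex. -/
lemma IsSeqColimit.exists_smoothCWComplex {A : ℕ → TopCat.{u}} {i : ∀ n, A n ⟶ A (n + 1)}
    [IsEmpty (A 0)] (d : ∀ n, DiskAttachment (i n) n) {Y : TopCat.{u}} {e : ∀ n, A n ⟶ Y}
    (he : IsSeqColimit i e) :
    ∃ (_ : DeltaGeneratedSpace Y) (X : DiffSpace.{u}), Nonempty (DiffSpace.SmoothCWComplex X) ∧
      DeltaGenerated.HomotopyEquivalent (DeltaGenerated.of Y) (DiffSpace.dTop.obj X) := by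
  have hA (n : ℕ) : DeltaGeneratedSpace (A n) := by
    induction n with
    | zero => exact ⟨continuous_iff_continuousAt.2 fun x ↦ isEmptyElim x⟩
    | succ n h => exact (d n).deltaGeneratedSpace
  obtain ⟨S₀, hE, hj₀⟩ := Stage.exists_of_isEmpty (A 0)
  obtain ⟨S, rfl, hS⟩ := exists_seq_of_step (L := fun n ↦ Stage (A n))
    (R := fun n S S' ↦ Nonempty (StageStep (i n) n S S')) S₀ fun n S ↦ S.exists_step (d n)
  have s (n : ℕ) := (hS n).some
  obtain ⟨X, ξ, hξ, hξ'⟩ := DiffSpace.exists_isSeqColimit fun n ↦ (s n).x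
  obtain ⟨Z, ζ, hζ⟩ := TopCat.exists_isSeqColimit fun n ↦ (s n).z
  obtain ⟨j, hj⟩ := he.exists_desc (fun n ↦ (S n).j ≫ ζ n) fun n ↦ by
    rw [← Category.assoc, (s n).comm_j, Category.assoc, hζ.comm]
  obtain ⟨k, hk⟩ := hξ'.exists_desc (fun n ↦ (S n).k ≫ ζ n) fun n ↦ by
    rw [← Category.assoc, (s n).comm_k, Category.assoc, hζ.comm]
  have hjc : CylAnodyne j := .of_isSeqColimit hj₀ (fun n ↦ (s n).rel_j) he.comm
    (fun _ _ _ ↦ he.hom_ext) hζ hj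
  have hkc : CylAnodyne k := .of_isSeqColimit (S 0).cylAnodyne_k (fun n ↦ (s n).rel_k) hξ'.comm
    (fun _ _ _ ↦ hξ'.hom_ext) hζ hk
  have hY := he.deltaGeneratedSpace hA
  have hX : DeltaGeneratedSpace (dTopCat.obj X) := DiffSpace.deltaGeneratedSpace_dTopology X
  exact ⟨hY, X, SmoothDiskAttachment.nonempty_smoothCWComplex (fun n ↦ (s n).attachment) hξ,
    DeltaGenerated.homotopyEquivalent_of_cylAnodyne hjc hkc⟩

end

theorem theorem2p4 (Y : TopCat.{u}) (hY : TopCat.CWComplex Y) :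
    ∃ (_ : DeltaGeneratedSpace Y) (X : DiffSpace.{u}), Nonempty (DiffSpace.SmoothCWComplex X) ∧
      DeltaGenerated.HomotopyEquivalent (DeltaGenerated.of Y) (DiffSpace.dTop.obj X) := by
  have hE : IsEmpty (hY.F.obj 0) := by
    let f : hY.F.obj 0 ⟶ TopCat.of PEmpty := hY.isoBot.hom ≫ initial.to _
    exact Function.isEmpty f
  have d (n : ℕ) : DiskAttachment (hY.F.map (homOfLE (n.le_add_right 1))) n :=
    (hY.attachCells n (not_isMax n)).nonempty_diskAttachment.some
  exact (IsSeqColimit.of_isColimit hY.isColimit).exists_smoothCWComplex d
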